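/- **Market.** Let $N\ge 2$ and $T\ge 2$. There are players $p_1,\dots,p_N$ and arms $a_1,\dots,a_N$; player $p_i$ owns arm $a_i$. Player $p_i$ has utility $U(i,j)\in[0,1]$ for arm $a_j$, and $U(i,j)\ne U(i,j')$ for $j\ne j'$. In each round $t=1,2,\dots$ every player $p_i$ proposes to an arm $A_i(t)$ or to none ($A_i(t)=\emptyset$). Let $A_j^{-1}(t)$ be the set of players that propose to $a_j$; only $p_j$ observes it. A proposal succeeds iff it is the only one to its arm. If the proposal of $p_i$ to $a_j$ succeeds, $p_i$ is matched to $a_j$ and receives a random $1$-subgaussian reward $X_i(t)$ with mean $U(i,j)$; otherwise $X_i(t)=0$. The reward tables (one entry per player-arm pair) of different rounds are independent. **Core regret.** A matching (bijection from players to arms) $\mu$ is in the core if there are no coalition $S$ and matching $\mu'$ such that $\mu'$ assigns to the members of $S$ arms owned by members of $S$, $U(i,\mu'(p_i))\ge U(i,\mu(p_i))$ for all $p_i\in S$, and the inequality is strict for some $p_i\in S$. Since preferences are strict, there is exactly one such matching $\mu^*$ (the outcome of Top Trading Cycles). The core regret of $p_i$ is $Reg_i(T)=T\cdot U(i,\mu^*(p_i))-\mathbb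 E\big[\sum_{t=1}^T X_i(t)\big]$. Let $r_{i,k}$ be the $k$-th preferred arm of $p_i$, let $\Delta_{\min}=\min_{i\in[N],\,1\le k<N}\big(U(i,r_{i,k})-U(i,r_{i,k+1})\big)$, and let $\Delta_{i,\max}$ be the largest regret that $p_i$ can suffer in one round, i.e. the maximum of $U(i,\mu^*(p_i))-v$ over $v\in\{0\}\cup\{U(i,j):j\in[N]\}$ ($v=0$ is the outcome of being unmatched). **Algorithm (known horizon $T$; every player $p_i$ runs it).** *Phase 1* consists of sub-phases $\ell=1,2,\dots$; sub-phase $\ell$ has $2^\ell$ exploration rounds followed by $N$ communication rounds. In exploration round $t$ (global clock), $A_i(t)=a_{((i+t-1)\bmod N)+1}$, and after a successful match $p_i$ updates its number of observations $T_{i,j}$ and empirical mean $\hat U(i,j)$ of the matched arm (both initially $0$, never reset). At the end of the exploration rounds, with $\mathrm{UCB}_{i,j},\mathrm{LCB}_{i,j}=\hat U(i,j)\pm\sqrt{6\log T/\max\{T_{i,j},1\}}$, player $p_i$ is *confident* if there is a permutation $\sigma_i$ of the arms with $\mathrm{LCB}_{i,\sigma_{i,k}}>\mathrm{UCB}_{i,\sigma_{i,k+1}}$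 for $1\le k<N$, and then stores it. In the $k$-th communication round $p_i$ proposes to $a_k$ if it is confident and to none otherwise. If $p_i$ receives $N$ proposals in the $i$-th communication round of a sub-phase, it enters phase 2 at the end of that sub-phase; otherwise it continues with the next sub-phase. *Phase 2.* Every player has a flag, initially up; the flags are public at all times, and an arm is available iff its owner's flag is up. The phase is divided into epochs; a new epoch starts at the beginning of phase 2 and after each round in which the set of available arms has changed. In the first round of an epoch, the player with the smallest index among those whose flag is up proposes to the available arm that it ranks best in $\sigma_i$; in every other round of the epoch, each player with its flag up that received a proposal in the previous round proposes to its best available arm, and records who had proposed to it. The other players whose flag is up make no proposal. If a player with its flag up has proposed in the current epoch (this round included) and receives a proposal in this round, it lowers its flag; in the same round, successively, every player with its flag up whose recorded proposer has a lowered flag also lowers its flag. A player that lowers its flag in a round proposes in all later rounds to the arm that was its best available arm at the beginning of that round. **Theorem.** If every player runs this algorithm, then for every player $p_i$ $$Reg_i(T)\le\Big(\frac{192N\log T}{\Delta_{\min}^2}+N\log\Big(\frac{192N\log T}{\Delta_{\min}^2}\Big)+3N^2\Big)\Delta_{i,\max}\le C\,\frac{N\log T}{\Delta_{\min}^2},$$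 where $\log$ is the natural logarithm and $C$ is an absolute constant; in particular $Reg_i(T)=O(N\log T/\Delta_{\min}^2)$. -/

import Mathlib

open MeasureTheory ProbabilityTheory

noncomputable section

namespace HousingMarket

open scoped Classical

variable {N : ℕ}

/-! ### Preferences, core matching, gaps

Players and arms are both indexed by `Fin N`; arm `i` is the endowment of player `i`.
`U i j` is the utility of arm `j` for player `i`. A matching is a permutation. -/

/-- The preference ranking of player `i`: position `k` holds the `k`-th preferred arm. -/
def prefRank (U : Fin N → Fin N → ℝ) (i : Fin N) : Equiv.Perm (Fin N) :=
  Tuple.sort (fun j => -U i j)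

/-- The minimum preference gap: the least gap between two arms that are consecutive in the
ranking of some player (a minimum over a finite set, nonempty when `2 ≤ N`). -/
def minGap (U : Fin N → Fin N → ℝ) : ℝ :=
  sInf {g | ∃ (i : Fin N) (k : ℕ) (hk : k + 1 < N),
    g = U i (prefRank U i ⟨k, Nat.lt_of_succ_lt hk⟩) - U i (prefRank U i ⟨k + 1, hk⟩)}

/-- The coalition `S` blocks the matching `μ` through the matching `μ'`: the members of `S`
redistribute their own endowments, nobody in `S` is worse off and somebody is better off. -/
def Blocks (U : Fin N → Fin N → ℝ) (μ : Equiv.Perm (Fin N)) (S : Finset (Fin N))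
    (μ' : Equiv.Perm (Fin N)) : Prop :=
  (∀ i ∈ S, μ' i ∈ S) ∧ (∀ i ∈ S, U i (μ i) ≤ U i (μ' i)) ∧ ∃ i ∈ S, U i (μ i) < U i (μ' i)

/-- `μ` is in the core: it is blocked by no coalition. -/
def IsCoreMatching (U : Fin N → Fin N → ℝ) (μ : Equiv.Perm (Fin N)) : Prop :=
  ∀ (S : Finset (Fin N)) (μ' : Equiv.Perm (Fin N)), ¬ Blocks U μ S μ'

/-- Expected reward of an outcome: `none` means that the player is unmatched. -/
def outcomeValue (U : Fin N → Fin N → ℝ) (i : Fin N) (o : Option (Fin N)) : ℝ :=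
  o.elim 0 (U i)

/-- The maximum core regret that player `i` may suffer in one round, over all outcomes
(including being unmatched). -/
def maxGap (U : Fin N → Fin N → ℝ) (μ : Equiv.Perm (Fin N)) (i : Fin N) : ℝ :=
  Finset.univ.sup' ⟨none, Finset.mem_univ _⟩
    (fun o : Option (Fin N) => U i (μ i) - outcomeValue U i o)

/-! ### One round of the market -/

/-- The players that propose to arm `j`, when `A i` is the proposal of player `i`
(`none`: no proposal). -/
def applicants (A : Fin N → Option (Fin N)) (j : Fin N) : Finset (Fin N) :=
  Finset.univ.filter (fun i => A i = some j)

/-- The arm that player `i` is matched to: a proposal succeeds iff it is the only one. -/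
def matched (A : Fin N → Option (Fin N)) (i : Fin N) : Option (Fin N) :=
  match A i with
  | none => none
  | some j => if (applicants A j).card = 1 then some j else none

/-- The reward of player `i`, where `x i j` is the reward of this round for the pair `(i, j)`. -/
def reward (x : Fin N → Fin N → ℝ) (A : Fin N → Option (Fin N)) (i : Fin N) : ℝ :=
  (matched A i).elim 0 (x i)

/-- What player `i` privately observes in a round: its own outcome and reward, and the players
that proposed to its own arm. -/
structure Observation (N : ℕ) where
  outcome : Option (Fin N)
  reward : ℝ
  applicants : Finset (Fin N)

/-! ### The algorithm, phase 1 (rounds are numbered from 1) -/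

/-- Private memory of a player in phase 1. -/
structure LearnState (N : ℕ) where
  /-- index of the current sub-phase -/
  sub : ℕ
  /-- empirical means -/
  est : Fin N → ℝ
  /-- numbers of observations -/
  cnt : Fin N → ℕ
  /-- the ranking found in this sub-phase, if any -/
  rank : Option (Equiv.Perm (Fin N))
  /-- whether `N` proposals were seen in the own communication round of this sub-phase -/
  ready : Bool

/-- The number of rounds before sub-phase `l`. -/
def subphaseStart (N l : ℕ) : ℕ := ∑ m ∈ Finset.Ico 1 l, (2 ^ m + N)

def radius (T n : ℕ) : ℝ := √(6 * Real.log T / max (n : ℝ) 1)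

namespace LearnState

def init (N : ℕ) : LearnState N :=
  { sub := 1, est := fun _ => 0, cnt := fun _ => 0, rank := none, ready := false }

def ucb (T : ℕ) (s : LearnState N) (j : Fin N) : ℝ := s.est j + radius T (s.cnt j)

def lcb (T : ℕ) (s : LearnState N) (j : Fin N) : ℝ := s.est j - radius T (s.cnt j)

/-- The confidence intervals are disjoint and ordered by `σ`. -/
def Separates (T : ℕ) (s : LearnState N) (σ : Equiv.Perm (Fin N)) : Prop :=
  ∀ (k : ℕ) (hk : k + 1 < N),
    s.ucb T (σ ⟨k + 1, hk⟩) < s.lcb T (σ ⟨k, Nat.lt_of_succ_lt hk⟩)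

def findRank (T : ℕ) (s : LearnState N) : Option (Equiv.Perm (Fin N)) :=
  if h : ∃ σ, s.Separates T σ then some h.choose else none

/-- The last exploration round of the current sub-phase. -/
def lastExplore (s : LearnState N) : ℕ := subphaseStart N s.sub + 2 ^ s.sub

/-- Exploration: round robin. In the `k`-th communication round: propose to the `k`-th arm
if a ranking was found, abstain otherwise. -/
def propose (i : Fin N) (t : ℕ) (s : LearnState N) : Option (Fin N) :=
  if t ≤ s.lastExplore then
    some ⟨(i.val + t) % N, Nat.mod_lt _ i.pos⟩
  else if s.rank.isSome then
    if h : t - s.lastExplore - 1 < N then some ⟨t - s.lastExplore - 1, h⟩ else none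
  else none

/-- Update of the empirical mean and of the number of observations after a successful match. -/
def record (s : LearnState N) (o : Observation N) : LearnState N :=
  match o.outcome with
  | none => s
  | some j =>
    { s with
      est := Function.update s.est j ((s.est j * s.cnt j + o.reward) / (s.cnt j + 1))
      cnt := Function.update s.cnt j (s.cnt j + 1) }

end LearnState

/-! ### The algorithm, phase 2 -/

/-- Private memory of a player in phase 2 whose own arm is still available. -/
structure TradeState (N : ℕ) where
  rank : Equiv.Perm (Fin N)
  /-- whether the coming round is the first one of an epoch -/
  first : Bool
  /-- the players that proposed to the own arm in the previous round -/
  inbox : Finset (Fin N)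
  /-- whether the player has proposed in the current epoch -/
  proposed : Bool
  /-- the proposer that triggered the player's latest proposal (at most one element) -/
  pred : Finset (Fin N)

/-- The best arm of `F` in the ranking `σ`. -/
def bestIn (σ : Equiv.Perm (Fin N)) (F : Finset (Fin N)) : Option (Fin N) :=
  if h : (Finset.univ.filter (fun k => σ k ∈ F)).Nonempty then
    some (σ ((Finset.univ.filter (fun k => σ k ∈ F)).min' h))
  else none

namespace TradeState

def init (σ : Equiv.Perm (Fin N)) : TradeState N :=
  { rank := σ, first := true, inbox := ∅, proposed := false, pred := ∅ }

/-- Whether player `i` proposes in this round, `F` being the set of available arms: in the first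
round of an epoch, only the player with the smallest available index does; in the other rounds,
those who received a proposal in the previous round do. -/
def Acts (i : Fin N) (F : Finset (Fin N)) (s : TradeState N) : Prop :=
  if s.first then IsLeast (F : Set (Fin N)) i else s.inbox.Nonempty

def propose (i : Fin N) (F : Finset (Fin N)) (s : TradeState N) : Option (Fin N) :=
  if s.Acts i F then bestIn s.rank F else none

/-- The memory right after the proposals of the round were made. -/
def mark (i : Fin N) (F : Finset (Fin N)) (s : TradeState N) : TradeState N :=
  { s with
    proposed := s.proposed || decide (s.Acts i F)
    pred := if s.first = false ∧ s.Acts i F then s.inbox else s.pred }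

end TradeState

/-- Memory of a player: in phase 1, in phase 2, or committed to an arm for ever. -/
inductive PlayerState (N : ℕ) where
  | learn (s : LearnState N)
  | trade (s : TradeState N)
  | settled (a : Option (Fin N))

/-- The flags that go down in a round, `F` being the set of players whose flag is up before it:
a player that has proposed in the current epoch and receives a proposal lowers its flag, and
so does every player whose triggering proposer has lowered its flag. -/
inductive FlagDown (F : Finset (Fin N)) (closes : Fin N → Prop)
    (pred : Fin N → Finset (Fin N)) : Fin N → Prop
  | close {i : Fin N} (hi : i ∈ F) (h : closes i) : FlagDown F closes pred i
  | old {i j : Fin N} (hi : i ∈ F) (hj : j ∈ pred i) (h : j ∉ F) : FlagDown F closes pred i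
  | copy {i j : Fin N} (hi : i ∈ F) (hj : j ∈ pred i) (h : FlagDown F closes pred j) :
      FlagDown F closes pred i

namespace PlayerState

/-- The proposal of player `i` in round `t`, a function of its own memory and of the publicly
known set `F` of available arms. -/
def propose (i : Fin N) (t : ℕ) (F : Finset (Fin N)) : PlayerState N → Option (Fin N)
  | learn s => s.propose i t
  | trade s => s.propose i F
  | settled a => a

/-- Player `i` has proposed in the current epoch (possibly in this round) and receives a
proposal in this round. -/
def Closes (i : Fin N) (F app : Finset (Fin N)) : PlayerState N → Prop
  | trade s => (s.mark i F).proposed = true ∧ app.Nonempty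
  | _ => False

/-- The proposer that triggered the latest proposal of player `i`. -/
def predOf (i : Fin N) (F : Finset (Fin N)) : PlayerState N → Finset (Fin N)
  | trade s => (s.mark i F).pred
  | _ => ∅

/-- Phase 1 memory update at the end of round `t`. A player enters phase 2 at the end of a
sub-phase if it saw `N` proposals in its own communication round. -/
def nextLearn (T : ℕ) (i : Fin N) (t : ℕ) (o : Observation N) (s : LearnState N) :
    PlayerState N :=
  if t < s.lastExplore then learn (s.record o)
  else if t = s.lastExplore then
    learn { s.record o with rank := (s.record o).findRank T }
  else
    let ready := s.ready || decide (t - s.lastExplore = i.val + 1 ∧ o.applicants.card = N)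
    if t < s.lastExplore + N then learn { s with ready := ready }
    else match ready, s.rank with
      | true, some σ => trade (TradeState.init σ)
      | _, _ => learn { s with sub := s.sub + 1, rank := none, ready := false }

/-- Phase 2 memory update, `F` and `F'` being the publicly known sets of available arms before
and after the round. -/
def nextTrade (i : Fin N) (F F' : Finset (Fin N)) (o : Observation N) (s : TradeState N) :
    PlayerState N :=
  if i ∈ F ∧ i ∉ F' then settled (bestIn s.rank F)
  else trade
    { s.mark i F with
      first := decide (F' ≠ F)
      inbox := o.applicants
      proposed := if F' ≠ F then false else (s.mark i F).proposed }

def next (T : ℕ) (i : Fin N) (t : ℕ) (F F' : Finset (Fin N)) (o : Observation N) :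
    PlayerState N → PlayerState N
  | learn s => nextLearn T i t o s
  | trade s => nextTrade i F F' o s
  | settled a => settled a

end PlayerState

/-! ### The joint run of all players -/

/-- The memories of all players and the public set of available arms. -/
structure World (N : ℕ) where
  player : Fin N → PlayerState N
  avail : Finset (Fin N)

namespace World

def init (N : ℕ) : World N :=
  { player := fun _ => PlayerState.learn (LearnState.init N), avail := Finset.univ }

def proposals (t : ℕ) (w : World N) : Fin N → Option (Fin N) :=
  fun i => (w.player i).propose i t w.avail

/-- The public set of available arms after round `t`. -/
def nextAvail (t : ℕ) (w : World N) : Finset (Fin N) :=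
  w.avail.filter (fun i => ¬ FlagDown w.avail
    (fun j => (w.player j).Closes j w.avail (applicants (w.proposals t) j))
    (fun j => (w.player j).predOf j w.avail) i)

/-- One round: round number `t`, rewards `x`. -/
def next (T t : ℕ) (x : Fin N → Fin N → ℝ) (w : World N) : World N :=
  { player := fun i => (w.player i).next T i t w.avail (w.nextAvail t)
      { outcome := matched (w.proposals t) i
        reward := reward x (w.proposals t) i
        applicants := applicants (w.proposals t) i }
    avail := w.nextAvail t }

end World

/-- The state after `n` rounds when every player runs the algorithm with horizon `T`; `x t i j`
is the reward that player `i` obtains in round `t` if it is matched to arm `j`. -/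
def run (T : ℕ) (x : ℕ → Fin N → Fin N → ℝ) : ℕ → World N
  | 0 => World.init N
  | n + 1 => (run T x n).next T (n + 1) (x (n + 1))

/-- The reward of player `i` in round `t ≥ 1`. -/
def receivedReward (T : ℕ) (x : ℕ → Fin N → Fin N → ℝ) (i : Fin N) (t : ℕ) : ℝ :=
  reward (x t) ((run T x (t - 1)).proposals t) i

/-! ### Stochastic rewards and regret -/

/-- The stochastic rewards: `ξ t i j` is the reward that player `i` obtains in round `t` if it is
matched to arm `j`. It has mean `U i j` and is 1-subgaussian; different rounds are independent
(no independence within a round and no identity of distributions is required). -/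
structure IsRewardModel {Ω : Type*} [MeasurableSpace Ω] (P : Measure Ω)
    (U : Fin N → Fin N → ℝ) (ξ : ℕ → Fin N → Fin N → Ω → ℝ) : Prop where
  measurable : ∀ t i j, Measurable (ξ t i j)
  mean : ∀ t i j, ∫ ω, ξ t i j ω ∂P = U i j
  subgaussian : ∀ t i j, HasSubgaussianMGF (fun ω => ξ t i j ω - U i j) 1 P
  indep : iIndepFun (fun (t : ℕ) (ω : Ω) (i j : Fin N) => ξ t i j ω) P

/-- The total reward of player `i` over `T` rounds. -/
def totalReward {Ω : Type*} (T : ℕ) (ξ : ℕ → Fin N → Fin N → Ω → ℝ) (i : Fin N) (ω : Ω) : ℝ :=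
  ∑ t ∈ Finset.Icc 1 T, receivedReward T (fun t i j => ξ t i j ω) i t

/-- The core regret of player `i` over `T` rounds with respect to the matching `μ`. -/
def coreRegret {Ω : Type*} [MeasurableSpace Ω] (P : Measure Ω) (T : ℕ)
    (U : Fin N → Fin N → ℝ) (μ : Equiv.Perm (Fin N)) (ξ : ℕ → Fin N → Fin N → Ω → ℝ)
    (i : Fin N) : ℝ :=
  T * U i (μ i) - ∫ ω, totalReward T ξ i ω ∂P

/-- The explicit regret bound. -/
def regretBound (N T : ℕ) (δ : ℝ) : ℝ :=
  192 * N * Real.log T / δ ^ 2 + N * Real.log (192 * N * Real.log T / δ ^ 2) + 3 * (N : ℝ) ^ 2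

end HousingMarket

end

/-! The regret is the expected sum over the rounds of the gap between the core arm and the realized
outcome. A round's outcome depends only on earlier reward tables, so it is independent of the
current table and the realized reward may be replaced by its mean (`IsRewardModel.coreRegret_eq`).
It remains to count the rounds in which a player misses its core arm.

Exploration is a fixed round robin: which rewards enter an estimate is deterministic as long as
phase 1 lasts. The memories of phase 1 therefore have a closed form in the reward table
(`obsState`), and ordinary subgaussian tails with a union bound show that all confidence intervals
used are correct, except on an event `B` with T · P(B) ≤ N²
(`IsRewardModel.measure_not_accurate_le`). Correct intervals that separate the arms give the true
ranking, and they do separate after 96 log T / δ² observations per arm, where δ is the minimum gap.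
The communication rounds detect exactly the event that everybody is confident, so all players enter
phase 2 together (`run_subphase_end`).

Phase 2 is Top Trading Cycles. In an epoch each proposal goes to the proposer's favourite available
arm and wakes its owner, so the chain of proposers is an orbit of `topArm`. When the orbit returns
to itself, its cycle settles, and a core matching must assign favourites along such a cycle
(`IsCoreMatching.eq_topArm`). An epoch with a available arms lasts at most a rounds, so N(N+1)/2
rounds suffice (`allSettled_of_init`).

Doubling sub-phases cost at most about twice the needed exploration, plus N communication rounds
each; explorations of the core arm are not missed rounds (`card_missed_le`). The rest is arithmetic
(`exists_subphase_of_samples`). -/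

noncomputable section

namespace HousingMarket

open scoped Classical

variable {N : ℕ}

/-! ### Rankings, favourite arms and the core. -/

section Ranking

variable {U : Fin N → Fin N → ℝ}

theorem strictAnti_prefRank (hinj : ∀ i, Function.Injective (U i)) (i : Fin N) :
    StrictAnti fun k => U i (prefRank U i k) := by
  have h : Monotone ((fun j => -U i j) ∘ prefRank U i) := Tuple.monotone_sort _
  refine Antitone.strictAnti_of_injective (fun a b hab => ?_)
    ((hinj i).comp (prefRank U i).injective)
  have := h hab
  simp only [Function.comp] at this
  linarith

theorem eq_prefRank (hinj : ∀ i, Function.Injective (U i)) (i : Fin N)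
    {σ : Equiv.Perm (Fin N)} (hσ : StrictAnti fun k => U i (σ k)) : σ = prefRank U i := by
  refine Tuple.eq_sort_iff.2 ⟨fun a b hab => ?_, fun a b hab he => ?_⟩
  · simpa [Function.comp] using hσ.antitone hab
  · have := hinj i (neg_injective he)
    exact absurd (σ.injective this) hab.ne

theorem exists_bestIn (σ : Equiv.Perm (Fin N)) {F : Finset (Fin N)} (hF : F.Nonempty) :
    ∃ k, σ k ∈ F ∧ bestIn σ F = some (σ k) ∧ ∀ k', σ k' ∈ F → k ≤ k' := by
  have h : (Finset.univ.filter (fun k => σ k ∈ F)).Nonempty := by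
    obtain ⟨j, hj⟩ := hF
    exact ⟨σ.symm j, by simpa using hj⟩
  refine ⟨_, ?_, dif_pos h, fun k' hk' => Finset.min'_le _ _ (by simpa using hk')⟩
  simpa using Finset.min'_mem _ h

/-- The arm of `F` that player `i` likes best. -/
def topArm (U : Fin N → Fin N → ℝ) (F : Finset (Fin N)) (i : Fin N) : Fin N :=
  (bestIn (prefRank U i) F).getD i

theorem bestIn_prefRank {F : Finset (Fin N)} (hF : F.Nonempty) (i : Fin N) :
    bestIn (prefRank U i) F = some (topArm U F i) := by
  obtain ⟨k, -, h, -⟩ := exists_bestIn (prefRank U i) hF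
  simp [topArm, h]

theorem topArm_mem {F : Finset (Fin N)} (hF : F.Nonempty) (i : Fin N) : topArm U F i ∈ F := by
  obtain ⟨k, hk, h, -⟩ := exists_bestIn (prefRank U i) hF
  simpa [topArm, h] using hk

theorem le_topArm (hinj : ∀ i, Function.Injective (U i)) {F : Finset (Fin N)} (i : Fin N)
    {j : Fin N} (hj : j ∈ F) : U i j ≤ U i (topArm U F i) := by
  obtain ⟨k, -, h, hk⟩ := exists_bestIn (prefRank U i) ⟨j, hj⟩
  have := (strictAnti_prefRank hinj i).antitone (hk ((prefRank U i).symm j) (by simpa using hj))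
  simpa [topArm, h] using this

theorem topArm_eq_of_subset (hinj : ∀ i, Function.Injective (U i)) {F F' : Finset (Fin N)}
    (hF : F' ⊆ F) {i : Fin N} (hi : topArm U F i ∈ F') : topArm U F' i = topArm U F i :=
  hinj i (le_antisymm (le_topArm hinj i (hF (topArm_mem ⟨_, hi⟩ i))) (le_topArm hinj i hi))

/-- A trading cycle of favourite arms is realized by every core matching. -/
theorem IsCoreMatching.eq_topArm (hinj : ∀ i, Function.Injective (U i))
    {μ : Equiv.Perm (Fin N)} (hμ : IsCoreMatching U μ) {F D : Finset (Fin N)}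
    (hF : ∀ i ∈ F, μ i ∈ F) (hDF : D ⊆ F) (hD : D.image (topArm U F) = D) {i : Fin N}
    (hi : i ∈ D) : μ i = topArm U F i := by
  have hmaps : ∀ i ∈ D, topArm U F i ∈ D := fun i hi => by
    have := Finset.mem_image_of_mem (topArm U F) hi
    rwa [hD] at this
  have hinjD : Set.InjOn (topArm U F) D := Finset.injOn_of_card_image_eq (by rw [hD])
  have hg : Function.Injective (fun a : {a // a ∈ D} => (⟨_, hmaps a a.2⟩ : {a // a ∈ D})) :=
    fun a b hab => Subtype.ext (hinjD a.2 b.2 (congrArg Subtype.val hab))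
  -- The blocking coalition is `D`, trading along favourites; `Equiv.Perm.ofSubtype` extends this
  -- trade by the identity outside `D`. Since `μ` keeps `F` inside `F`, no member of `D` loses, so
  -- any disagreement with `μ` is a strict gain.
  let e : Equiv.Perm {a // a ∈ D} := Equiv.ofBijective _ (Finite.injective_iff_bijective.1 hg)
  have he : ∀ a (ha : a ∈ D), Equiv.Perm.ofSubtype e a = topArm U F a := fun a ha => by
    rw [Equiv.Perm.ofSubtype_apply_of_mem e ha]; rfl
  by_contra hne
  refine hμ D (Equiv.Perm.ofSubtype e) ⟨fun a ha => ?_, fun a ha => ?_, i, hi, ?_⟩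
  · rw [he a ha]; exact hmaps a ha
  · rw [he a ha]; exact le_topArm hinj a (hF a (hDF ha))
  · rw [he i hi]
    exact lt_of_le_of_ne (le_topArm hinj i (hF i (hDF hi))) fun h => hne (hinj i h)

end Ranking

/-! ### Phase 2: trading cycles are found and settled in `N * (N + 1) / 2` rounds. -/

section Trading

variable {U : Fin N → Fin N → ℝ} {μ : Equiv.Perm (Fin N)}

/-- The `r`-th proposer of an epoch with available arms `F` and first proposer `p`. -/
def proposer (U : Fin N → Fin N → ℝ) (F : Finset (Fin N)) (p : Fin N) (r : ℕ) : Fin N :=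
  (topArm U F)^[r] p

theorem proposer_succ (F : Finset (Fin N)) (p : Fin N) (r : ℕ) :
    proposer U F p (r + 1) = topArm U F (proposer U F p r) :=
  Function.iterate_succ_apply' _ _ _

theorem proposer_mem {F : Finset (Fin N)} {p : Fin N} (hp : p ∈ F) (r : ℕ) :
    proposer U F p r ∈ F := by
  cases r with
  | zero => exact hp
  | succ r => rw [proposer_succ]; exact topArm_mem ⟨p, hp⟩ _

/-- The memory of an active player before round `m` of an epoch. -/
structure InEpoch (U : Fin N → Fin N → ℝ) (F : Finset (Fin N)) (p : Fin N) (m : ℕ) (i : Fin N)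
    (s : TradeState N) : Prop where
  rank : s.rank = prefRank U i
  first : s.first = decide (m = 0)
  inbox : ∀ r, m = r + 1 →
    s.inbox = if i = proposer U F p (r + 1) then {proposer U F p r} else ∅
  proposed : s.proposed = true ↔ ∃ r < m, i = proposer U F p r
  pred : ∀ j ∈ s.pred, j ∈ F ∧ topArm U F j = i
  chain : ∀ r, r + 1 < m → i = proposer U F p (r + 1) → proposer U F p r ∈ s.pred

/-- The state of the market before round `m` of an epoch that `p` opens. -/
structure EpochState (U : Fin N → Fin N → ℝ) (μ : Equiv.Perm (Fin N)) (p : Fin N) (m : ℕ)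
    (w : World N) : Prop where
  least : IsLeast (w.avail : Set (Fin N)) p
  core : ∀ i ∈ w.avail, μ i ∈ w.avail
  done : ∀ i ∉ w.avail, w.player i = .settled (some (μ i))
  active : ∀ i ∈ w.avail, ∃ s, w.player i = .trade s ∧ InEpoch U w.avail p m i s
  inj : Set.InjOn (proposer U w.avail p) (Set.Iic m)

/-- All players are committed to their arm in `μ`. -/
def AllSettled (μ : Equiv.Perm (Fin N)) (w : World N) : Prop :=
  ∀ i, w.player i = .settled (some (μ i))

theorem AllSettled.next {w : World N} (h : AllSettled μ w) (T t : ℕ) (x : Fin N → Fin N → ℝ) :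
    AllSettled μ (w.next T t x) := fun i => by
  simp only [World.next, h i, PlayerState.next]

theorem AllSettled.proposals {w : World N} (h : AllSettled μ w) (t : ℕ) (i : Fin N) :
    w.proposals t i = some (μ i) := by
  simp only [World.proposals, h i, PlayerState.propose]

theorem InEpoch.acts_iff {F : Finset (Fin N)} {p i : Fin N} {m : ℕ} {s : TradeState N}
    (h : InEpoch U F p m i s) (hp : IsLeast (F : Set (Fin N)) p) :
    s.Acts i F ↔ i = proposer U F p m := by
  rw [TradeState.Acts, h.first]
  cases m with
  | zero => simpa using ⟨fun hi => hi.unique hp, fun hi => by rw [hi]; exact hp⟩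
  | succ r =>
    rw [h.inbox r rfl]
    by_cases hi : i = proposer U F p (r + 1) <;> simp [hi]

theorem InEpoch.mark_proposed {F : Finset (Fin N)} {p i : Fin N} {m : ℕ} {s : TradeState N}
    (h : InEpoch U F p m i s) (hp : IsLeast (F : Set (Fin N)) p) :
    (s.mark i F).proposed = true ↔ ∃ r < m + 1, i = proposer U F p r := by
  have := h.acts_iff hp
  simp only [TradeState.mark, Bool.or_eq_true, decide_eq_true_eq, this, h.proposed]
  constructor
  · rintro (⟨r, hr, h⟩ | h)
    · exact ⟨r, by omega, h⟩
    · exact ⟨m, by omega, h⟩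
  · rintro ⟨r, hr, hi⟩
    rcases Nat.lt_succ_iff_lt_or_eq.1 hr with hr | rfl
    · exact .inl ⟨r, hr, hi⟩
    · exact .inr hi

/-- Recorded proposers survive from one epoch to the next. The first half bounds them from above:
even an old record comes from an available player whose favourite is still the recorder. The second
half says that the links of the present chain are all recorded. Distinctness of the chain so far
prevents a record from being overwritten. -/
theorem InEpoch.mark_pred {F : Finset (Fin N)} {p i : Fin N} {m : ℕ} {s : TradeState N}
    (h : InEpoch U F p m i s) (hp : IsLeast (F : Set (Fin N)) p)
    (hinj : Set.InjOn (proposer U F p) (Set.Iic m)) :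
    (∀ j ∈ (s.mark i F).pred, j ∈ F ∧ topArm U F j = i) ∧
      ∀ r, r + 1 < m + 1 → i = proposer U F p (r + 1) → proposer U F p r ∈ (s.mark i F).pred := by
  have hacts := h.acts_iff hp
  simp only [TradeState.mark, hacts, h.first]
  cases m with
  | zero => simpa using h.pred
  | succ q =>
    rw [h.inbox q rfl]
    by_cases hi : i = proposer U F p (q + 1)
    · simp only [← hi, if_true, Nat.add_eq_zero_iff, one_ne_zero, and_false, decide_false,
        and_self, Finset.mem_singleton, forall_eq]
      refine ⟨⟨proposer_mem hp.1 q, by rw [hi, proposer_succ]⟩, fun r hr hir => ?_⟩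
      rcases Nat.lt_succ_iff_lt_or_eq.1 hr with hr | hr
      · have : q + 1 = r + 1 := hinj (Set.mem_Iic.2 le_rfl) (Set.mem_Iic.2 hr.le) (hi ▸ hir)
        omega
      · obtain rfl : r = q := by omega
        rfl
    · simp only [hi, and_false, if_false]
      refine ⟨h.pred, fun r hr hir => h.chain r ?_ hir⟩
      rcases Nat.lt_succ_iff_lt_or_eq.1 hr with hr | hr
      · exact hr
      · obtain rfl : r = q := by omega
        exact absurd hir hi

/-- An injection of a finite set into itself is onto. Hence settled players never propose to an
available arm and cannot disturb the chain. -/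
theorem EpochState.mem_iff {p : Fin N} {m : ℕ} {w : World N} (h : EpochState U μ p m w)
    (i : Fin N) : μ i ∈ w.avail ↔ i ∈ w.avail := by
  refine ⟨fun hi => ?_, h.core i⟩
  have hsub : w.avail.image μ ⊆ w.avail := by
    intro j hj
    obtain ⟨k, hk, rfl⟩ := Finset.mem_image.1 hj
    exact h.core k hk
  have himg := Finset.eq_of_subset_of_card_le hsub
    (Finset.card_image_of_injective _ μ.injective).ge
  rw [← himg] at hi
  obtain ⟨k, hk, hki⟩ := Finset.mem_image.1 hi
  rwa [← μ.injective hki]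

theorem EpochState.proposals_of_mem {p : Fin N} {m : ℕ} {w : World N}
    (h : EpochState U μ p m w) (t : ℕ) {i : Fin N} (hi : i ∈ w.avail) :
    w.proposals t i =
      if i = proposer U w.avail p m then some (proposer U w.avail p (m + 1)) else none := by
  obtain ⟨s, hs, he⟩ := h.active i hi
  simp only [World.proposals, hs, PlayerState.propose, TradeState.propose, he.acts_iff h.least,
    he.rank, bestIn_prefRank ⟨i, hi⟩]
  split_ifs with hi'
  · rw [proposer_succ, hi']
  · rfl

theorem EpochState.applicants_eq {p : Fin N} {m : ℕ} {w : World N} (h : EpochState U μ p m w)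
    (t : ℕ) {j : Fin N} (hj : j ∈ w.avail) :
    applicants (w.proposals t) j =
      if j = proposer U w.avail p (m + 1) then {proposer U w.avail p m} else ∅ := by
  ext i
  simp only [applicants, Finset.mem_filter, Finset.mem_univ, true_and]
  by_cases hi : i ∈ w.avail
  · rw [h.proposals_of_mem t hi]
    by_cases hi' : i = proposer U w.avail p m <;>
      by_cases hj' : j = proposer U w.avail p (m + 1) <;> simp [hi', hj', eq_comm]
  · have hm := proposer_mem (U := U) h.least.1 m
    have hμ := mt (h.mem_iff i).1 hi
    have hi' : i ≠ proposer U w.avail p m := fun h => hi (h ▸ hm)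
    have hμ' : μ i ≠ j := fun h => hμ (h ▸ hj)
    simp only [World.proposals, h.done i hi, PlayerState.propose, Option.some.injEq, hμ', false_iff]
    split_ifs <;> simp [hi']

theorem EpochState.closes_iff {p : Fin N} {m : ℕ} {w : World N} (h : EpochState U μ p m w)
    (t : ℕ) {i : Fin N} (hi : i ∈ w.avail) :
    (w.player i).Closes i w.avail (applicants (w.proposals t) i) ↔
      i = proposer U w.avail p (m + 1) ∧ ∃ r < m + 1, i = proposer U w.avail p r := by
  obtain ⟨s, hs, he⟩ := h.active i hi
  rw [h.applicants_eq t hi, hs, PlayerState.Closes, he.mark_proposed h.least]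
  by_cases hi' : i = proposer U w.avail p (m + 1) <;> simp [hi']

/-- While the chain of proposals has not come back to itself, the epoch goes on. -/
theorem EpochState.next_of_new {p : Fin N} {m : ℕ} {w : World N} (h : EpochState U μ p m w)
    (T t : ℕ) (x : Fin N → Fin N → ℝ)
    (hnew : ∀ r < m + 1, proposer U w.avail p (m + 1) ≠ proposer U w.avail p r) :
    EpochState U μ p (m + 1) (w.next T t x) ∧ (w.next T t x).avail = w.avail := by
  have hav : w.nextAvail t = w.avail := by
    refine Finset.filter_true_of_mem fun i hiF hi => ?_
    clear hiF
    induction hi with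
    | close hi hc =>
      obtain ⟨h1, r, hr, h2⟩ := (h.closes_iff t hi).1 hc
      exact hnew r hr (h1 ▸ h2)
    | @old i j hi hj hjF =>
      obtain ⟨s, hs, he⟩ := h.active i hi
      simp only [hs, PlayerState.predOf] at hj
      exact hjF ((he.mark_pred h.least h.inj).1 j hj).1
    | copy _ _ _ ih => exact ih
  have hav' : (w.next T t x).avail = w.avail := hav
  refine ⟨⟨hav' ▸ h.least, hav' ▸ h.core, fun i hi => ?_, fun i hi => ?_, ?_⟩, hav'⟩
  · rw [hav'] at hi
    simp only [World.next, h.done i hi, PlayerState.next]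
  · rw [hav'] at hi ⊢
    obtain ⟨s, hs, he⟩ := h.active i hi
    have hpr := he.mark_proposed h.least
    have hpd := he.mark_pred h.least h.inj
    refine ⟨{ s.mark i w.avail with first := false, inbox := applicants (w.proposals t) i }, ?_,
      he.rank, by simp, ?_, hpr, hpd.1, hpd.2⟩
    · simp [World.next, hs, PlayerState.next, PlayerState.nextTrade, hav]
    · intro r hr
      obtain rfl : m = r := by omega
      exact h.applicants_eq t hi
  · rw [hav']
    intro a ha b hb hab
    simp only [Set.mem_Iic] at ha hb
    rcases Nat.le_succ_iff.1 ha with ha' | rfl <;> rcases Nat.le_succ_iff.1 hb with hb' | rfl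
    · exact h.inj ha' hb' hab
    · exact absurd hab.symm (hnew a (by omega))
    · exact absurd hab (hnew b (by omega))
    · rfl

/-- When the chain of proposals closes, the members of the cycle settle at their arms in `μ`. -/
theorem EpochState.next_of_cycle (hinj : ∀ i, Function.Injective (U i))
    (hμ : IsCoreMatching U μ) {p : Fin N} {m c : ℕ} {w : World N} (h : EpochState U μ p m w)
    (T t : ℕ) (x : Fin N → Fin N → ℝ) (hc : c < m + 1)
    (hcyc : proposer U w.avail p (m + 1) = proposer U w.avail p c) :
    (w.next T t x).avail.card < w.avail.card ∧
      (AllSettled μ (w.next T t x) ∨ ∃ p', EpochState U μ p' 0 (w.next T t x)) := by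
  set F := w.avail with hF
  set D : Finset (Fin N) := (Finset.Icc c m).image (proposer U F p) with hDdef
  have hDF : D ⊆ F := fun i hi => by
    obtain ⟨r, -, rfl⟩ := Finset.mem_image.1 hi
    exact proposer_mem h.least.1 r
  have hDimg : D.image (topArm U F) = D := by
    ext i
    simp only [hDdef, Finset.mem_image, Finset.mem_Icc, exists_exists_and_eq_and, ← proposer_succ]
    constructor
    · rintro ⟨r, ⟨h1, h2⟩, rfl⟩
      rcases Nat.lt_or_ge r m with h3 | h3
      · exact ⟨r + 1, ⟨by omega, by omega⟩, rfl⟩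
      · obtain rfl : r = m := by omega
        exact ⟨c, ⟨le_rfl, h1⟩, hcyc.symm⟩
    · rintro ⟨r, ⟨h1, h2⟩, rfl⟩
      rcases Nat.lt_or_ge c r with h3 | h3
      · exact ⟨r - 1, ⟨by omega, by omega⟩, by congr 1; omega⟩
      · obtain rfl : r = c := by omega
        exact ⟨m, ⟨h2, le_rfl⟩, hcyc⟩
  -- The chain closes at its `c`-th member; each later member of the cycle has recorded its
  -- predecessor, so copying reaches all of `D`. Conversely a recorder is the favourite of its
  -- recorded proposer, and `D` is closed under favourites, so copying never leaves `D`.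
  have hdown : ∀ i ∈ F, (FlagDown F
      (fun j => (w.player j).Closes j F (applicants (w.proposals t) j))
      (fun j => (w.player j).predOf j F) i ↔ i ∈ D) := by
    intro i hi
    constructor
    · intro hd
      clear hi
      induction hd with
      | close hi hcl =>
        rw [((h.closes_iff t hi).1 hcl).1, ← hF, hcyc]
        exact Finset.mem_image_of_mem _ (Finset.mem_Icc.2 ⟨le_rfl, by omega⟩)
      | @old i j hi hj hjF =>
        obtain ⟨s, hs, he⟩ := h.active i hi
        simp only [hs, PlayerState.predOf] at hj
        exact absurd ((he.mark_pred h.least h.inj).1 j hj).1 hjF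
      | @copy i j hi hj _ ih =>
        obtain ⟨s, hs, he⟩ := h.active i hi
        simp only [hs, PlayerState.predOf] at hj
        rw [← ((he.mark_pred h.least h.inj).1 j hj).2, ← hDimg]
        exact Finset.mem_image_of_mem _ ih
    · intro hd
      obtain ⟨r, hr, rfl⟩ := Finset.mem_image.1 hd
      clear hi hd
      obtain ⟨hr1, hr2⟩ := Finset.mem_Icc.1 hr
      clear hr
      induction r, hr1 using Nat.le_induction with
      | base =>
        refine .close (proposer_mem h.least.1 c) ?_
        rw [h.closes_iff t (proposer_mem h.least.1 c)]
        exact ⟨hcyc.symm, c, hc, rfl⟩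
      | succ r hr ih =>
        have hmem := proposer_mem (U := U) h.least.1 (r + 1)
        refine .copy hmem ?_ (ih (by omega))
        obtain ⟨s, hs, he⟩ := h.active _ hmem
        simp only [← hF] at hs
        simp only [hs, PlayerState.predOf]
        exact (he.mark_pred h.least h.inj).2 r (by omega) rfl
  have hav : w.nextAvail t = F \ D := by
    ext i
    simp only [World.nextAvail, Finset.mem_filter, Finset.mem_sdiff, ← hF]
    exact and_congr_right fun hi => not_congr (hdown i hi)
  have hav' : (w.next T t x).avail = F \ D := hav
  have hcore : ∀ i ∈ D, μ i = topArm U F i := fun i hi => hμ.eq_topArm hinj h.core hDF hDimg hi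
  have hcD : proposer U F p c ∈ D :=
    Finset.mem_image_of_mem _ (Finset.mem_Icc.2 ⟨le_rfl, by omega⟩)
  have hmD : ∀ i ∈ D, μ i ∈ D := fun i hi => by
    rw [hcore i hi, ← hDimg]; exact Finset.mem_image_of_mem _ hi
  have hmD' : ∀ i, μ i ∈ D → i ∈ D := fun i hi => by
    have himg := Finset.eq_of_subset_of_card_le (s := D.image μ) (t := D)
      (fun j hj => by
        obtain ⟨k, hk, rfl⟩ := Finset.mem_image.1 hj
        exact hmD k hk) (Finset.card_image_of_injective _ μ.injective).ge
    rw [← himg] at hi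
    obtain ⟨k, hk, hki⟩ := Finset.mem_image.1 hi
    rwa [← μ.injective hki]
  have hne : F \ D ≠ F := fun he => by
    exact (Finset.mem_sdiff.1 (he.ge (hDF hcD))).2 hcD
  have hsettled : ∀ i ∉ F \ D, (w.next T t x).player i = .settled (some (μ i)) := by
    intro i hi
    by_cases hiF : i ∈ F
    · have hiD : i ∈ D := by simpa [hiF] using hi
      obtain ⟨s, hs, he⟩ := h.active i hiF
      have : i ∈ F ∧ i ∉ F \ D := ⟨hiF, hi⟩
      simp only [World.next, hs, PlayerState.next, PlayerState.nextTrade, hav, ← hF, if_pos this,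
        he.rank, bestIn_prefRank ⟨i, hiF⟩, hcore i hiD]
    · simp only [World.next, h.done i hiF, PlayerState.next]
  refine ⟨?_, ?_⟩
  · rw [hav']
    exact Finset.card_lt_card ⟨Finset.sdiff_subset, fun hs => hne (le_antisymm
      Finset.sdiff_subset hs)⟩
  rcases (F \ D).eq_empty_or_nonempty with hemp | hnon
  · exact .inl fun i => hsettled i (by rw [hemp]; exact Finset.notMem_empty i)
  refine .inr ⟨(F \ D).min' hnon, ?_, fun i hi => ?_,
    fun i hi => hsettled i (hav' ▸ hi), fun i hi => ?_, ?_⟩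
  · rw [hav']; exact Finset.isLeast_min' _ hnon
  · rw [hav', Finset.mem_sdiff] at hi ⊢
    exact ⟨h.core i hi.1, fun hμi => hi.2 (hmD' i hμi)⟩
  · rw [hav'] at hi ⊢
    obtain ⟨hiF, hiD⟩ := Finset.mem_sdiff.1 hi
    obtain ⟨s, hs, he⟩ := h.active i hiF
    have hpd := he.mark_pred h.least h.inj
    refine ⟨{ s.mark i F with
      first := true, inbox := applicants (w.proposals t) i, proposed := false }, ?_,
      he.rank, by simp, by simp, by simp, fun j hj => ?_, by simp⟩
    · simp [World.next, hs, PlayerState.next, PlayerState.nextTrade, hav, hiF, hiD, ← hF, hne]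
    -- A record kept by a survivor `i` stays valid: its proposer `j` did not settle, otherwise its
    -- favourite `i` would have settled too, and the favourite of `j` is unchanged because `i` is
    -- still available.
    · obtain ⟨hjF, hj'⟩ := hpd.1 j hj
      have hjD : j ∉ D := fun hjD => hiD <| by
        rw [← hj', ← hDimg]; exact Finset.mem_image_of_mem _ hjD
      refine ⟨Finset.mem_sdiff.2 ⟨hjF, hjD⟩, ?_⟩
      rw [topArm_eq_of_subset hinj Finset.sdiff_subset (by rwa [hj']), hj']
  · intro a ha b hb _
    simp only [Set.mem_Iic, nonpos_iff_eq_zero] at ha hb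
    rw [ha, hb]

/-- The chain consists of `m + 1` distinct available players. -/
theorem EpochState.lt_card {p : Fin N} {m : ℕ} {w : World N} (h : EpochState U μ p m w) :
    m < w.avail.card := by
  have := Finset.card_le_card_of_injOn (s := Finset.Iic m) (t := w.avail) (proposer U w.avail p)
    (fun r _ => proposer_mem h.least.1 r) (by simpa using h.inj)
  simpa using this

theorem AllSettled.run {T : ℕ} {x : ℕ → Fin N → Fin N → ℝ} {n : ℕ}
    (h : AllSettled μ (run T x n)) {n' : ℕ} (hn : n ≤ n') : AllSettled μ (run T x n') := by
  induction n', hn using Nat.le_induction with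
  | base => exact h
  | succ n' _ ih => exact ih.next _ _ _

/-- With `a` available arms, the epochs still to be played, the present one included, need at most
`a + (a - 1) + ... + 1` rounds, of which `m` are already spent; `k` is the number of rounds left. An
epoch that closes after `m + 1 ≤ a` rounds leaves at most `a - 1` arms, so the inequality persists.
-/
theorem EpochState.run_allSettled (hinj : ∀ i, Function.Injective (U i))
    (hμ : IsCoreMatching U μ) {T : ℕ} {x : ℕ → Fin N → Fin N → ℝ} (k : ℕ) :
    ∀ {n : ℕ} {p : Fin N} {m : ℕ}, EpochState U μ p m (run T x n) →
      (run T x n).avail.card * ((run T x n).avail.card + 1) ≤ 2 * (k + m) →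
      AllSettled μ (run T x (n + k)) := by
  induction k with
  | zero =>
    intro n p m h hk
    have := h.lt_card
    nlinarith
  | succ k ih =>
    intro n p m h hk
    have hm := h.lt_card
    rw [show n + (k + 1) = n + 1 + k by ring]
    by_cases hnew : ∀ r < m + 1,
        proposer U (run T x n).avail p (m + 1) ≠ proposer U (run T x n).avail p r
    · obtain ⟨h1, h2⟩ := h.next_of_new T (n + 1) (x (n + 1)) hnew
      refine ih (n := n + 1) h1 ?_
      rw [run, h2]
      linarith
    · push Not at hnew
      obtain ⟨c, hc, hcyc⟩ := hnew
      obtain ⟨hlt, h1 | ⟨p', h1⟩⟩ := h.next_of_cycle hinj hμ T (n + 1) (x (n + 1)) hc hcyc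
      · exact AllSettled.run (n := n + 1) h1 (by omega)
      · refine ih (n := n + 1) h1 ?_
        rw [run]
        nlinarith

/-- If all players enter phase 2 at the end of round `n` with their true rankings, then
`N * (N + 1) / 2` rounds later they are committed to the core matching. -/
theorem allSettled_of_init (hN : 0 < N) (hinj : ∀ i, Function.Injective (U i))
    (hμ : IsCoreMatching U μ) {T n : ℕ} {x : ℕ → Fin N → Fin N → ℝ}
    (h : run T x n = ⟨fun i => .trade (TradeState.init (prefRank U i)), Finset.univ⟩) {k : ℕ}
    (hk : N * (N + 1) ≤ 2 * k) : AllSettled μ (run T x (n + k)) := by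
  have hne : (Finset.univ : Finset (Fin N)).Nonempty := ⟨⟨0, hN⟩, Finset.mem_univ _⟩
  refine EpochState.run_allSettled hinj hμ k (p := Finset.univ.min' hne) (m := 0) ?_ ?_
  · rw [h]
    refine ⟨Finset.isLeast_min' _ hne, by simp, by simp, fun i _ => ⟨_, rfl, rfl, rfl, ?_, ?_, ?_,
      ?_⟩, fun a ha b hb _ => ?_⟩
    · simp
    · simp [TradeState.init]
    · simp [TradeState.init]
    · simp
    · simp only [Set.mem_Iic, nonpos_iff_eq_zero] at ha hb
      rw [ha, hb]
  · rw [h]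
    simpa using hk

end Trading

/-! ### Phase 1: closed form of the memories and joint entry into phase 2. -/

section Learning

variable {T : ℕ} {x : ℕ → Fin N → Fin N → ℝ}

/-- The round in which the `e`-th exploration (counted from `0`) takes place. -/
def exploreTime (N e : ℕ) : ℕ := e + 1 + N * (Nat.log 2 (e + 2) - 1)

/-- The arm that player `i` explores at the `e`-th exploration. -/
def exploreArm (i : Fin N) (e : ℕ) : Fin N := ⟨(i.val + (e + 1)) % N, Nat.mod_lt _ i.pos⟩

/-- The explorations of arm `j` by player `i` among the first `e` ones. -/
def explorations (i j : Fin N) (e : ℕ) : Finset ℕ :=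
  (Finset.range e).filter fun e' => exploreArm i e' = j

/-- The phase 1 memory of player `i` in sub-phase `l` after `e` explorations. -/
def obsState (x : ℕ → Fin N → Fin N → ℝ) (l : ℕ) (i : Fin N) (e : ℕ) : LearnState N where
  sub := l
  est j := (∑ e' ∈ explorations i j e, x (exploreTime N e') i j) / (explorations i j e).card
  cnt j := (explorations i j e).card
  rank := none
  ready := false

/-- The ranking that player `i` finds in sub-phase `l + 1`, if it gets there. -/
def foundRank (T : ℕ) (x : ℕ → Fin N → Fin N → ℝ) (l : ℕ) (i : Fin N) :
    Option (Equiv.Perm (Fin N)) :=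
  (obsState x (l + 1) i (2 ^ (l + 2) - 2)).findRank T

def AllConfident (T : ℕ) (x : ℕ → Fin N → Fin N → ℝ) (l : ℕ) : Prop :=
  ∀ i, (foundRank T x l i).isSome

/-- The market in the exploration rounds of sub-phase `l + 1`, after `k` of them. -/
def exploreWorld (x : ℕ → Fin N → Fin N → ℝ) (l k : ℕ) : World N where
  player i := .learn (obsState x (l + 1) i (2 ^ (l + 1) - 2 + k))
  avail := Finset.univ

/-- The market in the communication rounds of sub-phase `l + 1`, after `c` of them. -/
def commWorld (T : ℕ) (x : ℕ → Fin N → Fin N → ℝ) (l c : ℕ) : World N where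
  player i := .learn { obsState x (l + 1) i (2 ^ (l + 2) - 2) with
    rank := foundRank T x l i
    ready := decide (i.val < c ∧ AllConfident T x l) }
  avail := Finset.univ

theorem subphaseStart_succ (N l : ℕ) :
    subphaseStart N (l + 2) = subphaseStart N (l + 1) + (2 ^ (l + 1) + N) :=
  Finset.sum_Ico_succ_top (by omega) _

theorem subphaseStart_add_two (N l : ℕ) :
    subphaseStart N (l + 1) + 2 = 2 ^ (l + 1) + N * l := by
  induction l with
  | zero => simp [subphaseStart]
  | succ l ih => rw [subphaseStart_succ, pow_succ 2 (l + 1)]; linarith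

theorem two_le_two_pow_succ (l : ℕ) : 2 ≤ 2 ^ (l + 1) := by
  rw [pow_succ]; have := Nat.one_le_two_pow (n := l); omega

/-- Before sub-phase `l + 1` there are `2 + 4 + ... + 2 ^ l = 2 ^ (l + 1) - 2` explorations, so `e +
2` stays between consecutive powers of two during a sub-phase and its logarithm counts the
communication blocks already passed. -/
theorem exploreTime_eq {l k : ℕ} (hk : k < 2 ^ (l + 1)) :
    exploreTime N (2 ^ (l + 1) - 2 + k) = subphaseStart N (l + 1) + k + 1 := by
  have h2 := two_le_two_pow_succ l
  have h3 := subphaseStart_add_two N l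
  have hlog : Nat.log 2 (2 ^ (l + 1) - 2 + k + 2) = l + 1 :=
    Nat.log_eq_of_pow_le_of_lt_pow (by omega) (by rw [pow_succ 2 (l + 1)]; omega)
  rw [exploreTime, hlog, Nat.add_sub_cancel]
  omega

/-- A communication block has exactly `N` rounds, so it does not shift the round robin, although the
latter follows the global clock. -/
theorem exploreTime_mod (N e : ℕ) (i : ℕ) : (i + exploreTime N e) % N = (i + (e + 1)) % N := by
  rw [exploreTime, ← add_assoc, Nat.add_mul_mod_self_left]

theorem exploreTime_strictMono (N : ℕ) : StrictMono (exploreTime N) :=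
  strictMono_nat_of_lt_succ fun e => by
    have : Nat.log 2 (e + 2) - 1 ≤ Nat.log 2 (e + 1 + 2) - 1 :=
      Nat.sub_le_sub_right (Nat.log_mono_right (by omega)) _
    have := Nat.mul_le_mul_left N this
    unfold exploreTime
    omega

theorem exploreArm_injective (e : ℕ) : Function.Injective fun i : Fin N => exploreArm i e := by
  intro a b hab
  have h : (a.val + (e + 1)) ≡ (b.val + (e + 1)) [MOD N] := congrArg Fin.val hab
  have := Nat.ModEq.add_right_cancel' _ h
  exact Fin.ext (Nat.ModEq.eq_of_lt_of_lt this a.2 b.2)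

theorem explorations_succ (i j : Fin N) (e : ℕ) : explorations i j (e + 1) =
    if exploreArm i e = j then insert e (explorations i j e) else explorations i j e := by
  rw [explorations, Finset.range_add_one, Finset.filter_insert]
  rfl

theorem notMem_explorations (i j : Fin N) (e : ℕ) : e ∉ explorations i j e := by
  simp [explorations]

theorem nextAvail_of_learn {w : World N} (t : ℕ) (h : ∀ i, ∃ s, w.player i = .learn s) :
    w.nextAvail t = w.avail := by
  refine Finset.filter_true_of_mem fun i hiF hi => ?_
  clear hiF
  induction hi with
  | @close i hi hc => obtain ⟨s, hs⟩ := h i; simp [hs, PlayerState.Closes] at hc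
  | @old i j hi hj => obtain ⟨s, hs⟩ := h i; simp [hs, PlayerState.predOf] at hj
  | copy _ _ _ ih => exact ih

theorem matched_of_injective {A : Fin N → Option (Fin N)} {f : Fin N → Fin N}
    (hf : Function.Injective f) (hA : ∀ i, A i = some (f i)) (i : Fin N) :
    matched A i = some (f i) := by
  have : applicants A (f i) = {i} := by
    ext k; simp [applicants, hA, hf.eq_iff]
  simp [matched, hA, this]

theorem exploreWorld_proposals {l k : ℕ} (hk : k < 2 ^ (l + 1)) (i : Fin N) :
    (exploreWorld x l k).proposals (subphaseStart N (l + 1) + k + 1) i =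
      some (exploreArm i (2 ^ (l + 1) - 2 + k)) := by
  have : subphaseStart N (l + 1) + k + 1 ≤
      (obsState x (l + 1) i (2 ^ (l + 1) - 2 + k)).lastExplore := by
    simp only [obsState, LearnState.lastExplore]; omega
  simp only [World.proposals, exploreWorld, PlayerState.propose, LearnState.propose]
  rw [if_pos this]
  simp only [← exploreTime_eq hk, exploreTime_mod, exploreArm]

theorem obsState_record (l : ℕ) (i : Fin N) (e : ℕ) (app : Finset (Fin N)) :
    (obsState x l i e).record ⟨some (exploreArm i e), x (exploreTime N e) i (exploreArm i e), app⟩ =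
      obsState x l i (e + 1) := by
  have hc : ∀ j, ((explorations i j (e + 1)).card : ℕ) =
      if exploreArm i e = j then (explorations i j e).card + 1 else (explorations i j e).card := by
    intro j
    rw [explorations_succ]
    split_ifs with h
    · rw [Finset.card_insert_of_notMem (notMem_explorations i j e)]
    · rfl
  simp only [LearnState.record, obsState, LearnState.mk.injEq, true_and, and_true]
  constructor
  · funext j
    by_cases h : j = exploreArm i e
    · subst h
      rw [Function.update_self, hc, if_pos rfl, explorations_succ, if_pos rfl,
        Finset.sum_insert (notMem_explorations _ _ e)]
      -- Before the first observation the closed form is `0 / 0 = 0`, which agrees with the initial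
      -- estimate but does not allow the denominator to be cancelled.
      rcases eq_or_ne (explorations i (exploreArm i e) e).card 0 with h0 | h0
      · rw [Finset.card_eq_zero] at h0
        simp [h0]
      · rw [div_mul_cancel₀ _ (Nat.cast_ne_zero.2 h0), add_comm]
        push_cast
        rfl
    · rw [Function.update_of_ne h, hc, if_neg (Ne.symm h), explorations_succ, if_neg (Ne.symm h)]
  · funext j
    by_cases h : j = exploreArm i e
    · subst h
      rw [Function.update_self, hc, if_pos rfl]
    · rw [Function.update_of_ne h, hc, if_neg (Ne.symm h)]

theorem exploreWorld_next {l k : ℕ} (hk : k < 2 ^ (l + 1)) (i : Fin N) :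
    ((exploreWorld x l k).next T (subphaseStart N (l + 1) + k + 1)
      (x (subphaseStart N (l + 1) + k + 1))).player i =
      if k + 1 < 2 ^ (l + 1) then .learn (obsState x (l + 1) i (2 ^ (l + 1) - 2 + (k + 1)))
      else .learn { obsState x (l + 1) i (2 ^ (l + 2) - 2) with rank := foundRank T x l i } := by
  have hm := matched_of_injective (exploreArm_injective (N := N) (2 ^ (l + 1) - 2 + k))
    (exploreWorld_proposals (x := x) hk) i
  have hlast : (obsState x (l + 1) i (2 ^ (l + 1) - 2 + k)).lastExplore =
    subphaseStart N (l + 1) + 2 ^ (l + 1) := rfl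
  simp only [World.next, reward, hm]
  simp only [exploreWorld, PlayerState.next, PlayerState.nextLearn, hlast, Option.elim]
  rw [← exploreTime_eq hk, obsState_record, exploreTime_eq hk]
  by_cases h1 : k + 1 < 2 ^ (l + 1)
  · rw [if_pos (by omega), if_pos h1]
    rfl
  · rw [if_neg (by omega), if_pos (by omega), if_neg h1]
    have : 2 ^ (l + 1) - 2 + k + 1 = 2 ^ (l + 2) - 2 := by
      rw [pow_succ 2 (l + 1)]; have := two_le_two_pow_succ l; omega
    rw [this]
    rfl

theorem exploreWorld_nextAvail (l k t : ℕ) : (exploreWorld x l k).nextAvail t = Finset.univ :=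
  nextAvail_of_learn t fun _ => ⟨_, rfl⟩

theorem commWorld_nextAvail (l c t : ℕ) : (commWorld T x l c).nextAvail t = Finset.univ :=
  nextAvail_of_learn t fun _ => ⟨_, rfl⟩

theorem run_explore {l : ℕ} (h : run T x (subphaseStart N (l + 1)) = exploreWorld x l 0) {k : ℕ}
    (hk : k < 2 ^ (l + 1)) : run T x (subphaseStart N (l + 1) + k) = exploreWorld x l k := by
  induction k with
  | zero => exact h
  | succ k ih =>
    rw [← add_assoc, run, ih (by omega)]
    have hp : ((exploreWorld x l k).next T (subphaseStart N (l + 1) + k + 1)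
      (x (subphaseStart N (l + 1) + k + 1))).player = (exploreWorld x l (k + 1)).player := by
      funext i
      rw [exploreWorld_next (by omega), if_pos hk]
      rfl
    have ha : ((exploreWorld x l k).next T (subphaseStart N (l + 1) + k + 1)
      (x (subphaseStart N (l + 1) + k + 1))).avail = (exploreWorld x l (k + 1)).avail :=
      exploreWorld_nextAvail _ _ _
    rw [World.mk.injEq]
    exact ⟨hp, ha⟩

theorem commWorld_proposals {l c : ℕ} (hc : c < N) (i : Fin N) :
    (commWorld T x l c).proposals (subphaseStart N (l + 1) + 2 ^ (l + 1) + c + 1) i =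
      if (foundRank T x l i).isSome then some ⟨c, hc⟩ else none := by
  have hlast : ∀ r b, LearnState.lastExplore { obsState x (l + 1) i (2 ^ (l + 2) - 2) with
    rank := r, ready := b } = subphaseStart N (l + 1) + 2 ^ (l + 1) := fun _ _ => rfl
  simp only [World.proposals, commWorld, PlayerState.propose, LearnState.propose, hlast]
  rw [if_neg (by omega)]
  have h2 : subphaseStart N (l + 1) + 2 ^ (l + 1) + c + 1 -
    (subphaseStart N (l + 1) + 2 ^ (l + 1)) - 1 = c := by omega
  simp only [h2, hc, dif_pos]

/-- In communication round `c + 1` the confident players are exactly the applicants of arm `c` (arms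
counted from 0), so its owner sees `N` proposals iff all players are confident. Hence all owners
reach the same verdict. -/
theorem commWorld_ready {l c : ℕ} (hc : c < N) (i : Fin N) :
    (decide (i.val < c ∧ AllConfident T x l) || decide (c + 1 = i.val + 1 ∧
      (applicants ((commWorld T x l c).proposals
        (subphaseStart N (l + 1) + 2 ^ (l + 1) + c + 1)) i).card = N)) =
      decide (i.val < c + 1 ∧ AllConfident T x l) := by
  have hcard : c = i.val → ((applicants ((commWorld T x l c).proposals
        (subphaseStart N (l + 1) + 2 ^ (l + 1) + c + 1)) i).card = N ↔ AllConfident T x l) := by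
    rintro rfl
    conv_lhs => rhs; rw [← Fintype.card_fin N]
    rw [Finset.card_eq_iff_eq_univ, Finset.eq_univ_iff_forall]
    simp only [applicants, Finset.mem_filter, Finset.mem_univ, true_and, commWorld_proposals hc]
    refine forall_congr' fun k => ?_
    split_ifs with hk <;> simp [hk]
  rw [Bool.eq_iff_iff]
  simp only [Bool.or_eq_true, decide_eq_true_eq]
  constructor
  · rintro (⟨h1, h2⟩ | ⟨h1, h2⟩)
    · exact ⟨by omega, h2⟩
    · exact ⟨by omega, (hcard (by omega)).1 h2⟩
  · rintro ⟨h1, h2⟩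
    rcases Nat.lt_succ_iff_lt_or_eq.1 h1 with h | h
    · exact .inl ⟨h, h2⟩
    · exact .inr ⟨by omega, (hcard h.symm).2 h2⟩

theorem commWorld_next {l c : ℕ} (hc : c < N) (i : Fin N) :
    ((commWorld T x l c).next T (subphaseStart N (l + 1) + 2 ^ (l + 1) + c + 1)
      (x (subphaseStart N (l + 1) + 2 ^ (l + 1) + c + 1))).player i =
      if c + 1 < N then (commWorld T x l (c + 1)).player i
      else if AllConfident T x l then
        .trade (TradeState.init ((foundRank T x l i).getD 1))
      else (exploreWorld x (l + 1) 0).player i := by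
  have hr := commWorld_ready (T := T) (x := x) (l := l) hc i
  have hlast : ∀ r b, LearnState.lastExplore { obsState x (l + 1) i (2 ^ (l + 2) - 2) with
    rank := r, ready := b } = subphaseStart N (l + 1) + 2 ^ (l + 1) := fun _ _ => rfl
  have h2 : subphaseStart N (l + 1) + 2 ^ (l + 1) + c + 1 -
    (subphaseStart N (l + 1) + 2 ^ (l + 1)) = c + 1 := by omega
  simp only [World.next]
  generalize applicants ((commWorld T x l c).proposals
        (subphaseStart N (l + 1) + 2 ^ (l + 1) + c + 1)) i = app at hr ⊢
  simp only [commWorld, PlayerState.next, PlayerState.nextLearn, hlast, h2, hr]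
  rw [if_neg (by omega), if_neg (by omega)]
  by_cases h3 : c + 1 < N
  · rw [if_pos (by omega), if_pos h3]
  rw [if_neg (by omega), if_neg h3]
  by_cases h5 : AllConfident T x l
  · obtain ⟨σ, hσ⟩ := Option.isSome_iff_exists.1 (h5 i)
    have : i.val < c + 1 := by have := i.2; omega
    simp [h5, hσ, this]
  · simp only [h5, and_false, decide_false, if_false]
    rfl

theorem run_comm {l : ℕ} (h : run T x (subphaseStart N (l + 1)) = exploreWorld x l 0) {c : ℕ}
    (hc : c < N) :
    run T x (subphaseStart N (l + 1) + 2 ^ (l + 1) + c) = commWorld T x l c := by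
  induction c with
  | zero =>
    have h2 := two_le_two_pow_succ l
    obtain ⟨k, hk⟩ : ∃ k, 2 ^ (l + 1) = k + 1 := ⟨2 ^ (l + 1) - 1, by omega⟩
    rw [add_zero, hk, ← add_assoc, run, run_explore h (by omega)]
    have hp : ((exploreWorld x l k).next T (subphaseStart N (l + 1) + k + 1)
      (x (subphaseStart N (l + 1) + k + 1))).player = (commWorld T x l 0).player := by
      funext i
      rw [exploreWorld_next (by omega), if_neg (by omega)]
      simp [commWorld]
      rfl
    rw [World.mk.injEq]
    exact ⟨hp, exploreWorld_nextAvail _ _ _⟩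
  | succ c ih =>
    rw [← add_assoc, run, ih (by omega)]
    rw [World.mk.injEq]
    refine ⟨?_, commWorld_nextAvail _ _ _⟩
    funext i
    have := commWorld_next (T := T) (x := x) (l := l) (c := c) (by omega) i
    rw [if_pos hc] at this
    exact this

theorem run_subphase_end (hN : 0 < N) {l : ℕ}
    (h : run T x (subphaseStart N (l + 1)) = exploreWorld x l 0) :
    run T x (subphaseStart N (l + 2)) =
      if AllConfident T x l then
        ⟨fun i => .trade (TradeState.init ((foundRank T x l i).getD 1)), Finset.univ⟩
      else exploreWorld x (l + 1) 0 := by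
  obtain ⟨c, rfl⟩ : ∃ c, N = c + 1 := ⟨N - 1, by omega⟩
  rw [subphaseStart_succ, ← add_assoc, ← add_assoc, run, run_comm h (by omega)]
  have := fun i => commWorld_next (T := T) (x := x) (l := l) (c := c) (by omega) i
  simp only [lt_irrefl, if_false] at this
  have hw : ∀ w : World (c + 1), (∀ i, ((commWorld T x l c).next T
      (subphaseStart (c + 1) (l + 1) + 2 ^ (l + 1) + c + 1)
      (x (subphaseStart (c + 1) (l + 1) + 2 ^ (l + 1) + c + 1))).player i = w.player i) →
      w.avail = Finset.univ → (commWorld T x l c).next T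
      (subphaseStart (c + 1) (l + 1) + 2 ^ (l + 1) + c + 1)
      (x (subphaseStart (c + 1) (l + 1) + 2 ^ (l + 1) + c + 1)) = w := by
    intro w h1 h2
    cases w
    rw [World.mk.injEq]
    exact ⟨funext h1, (commWorld_nextAvail _ _ _).trans h2.symm⟩
  refine hw _ (fun i => ?_) ?_
  · rw [this i]; split_ifs <;> rfl
  · split_ifs <;> rfl

/-- As long as some player was not confident in each earlier sub-phase, phase 1 goes on. -/
theorem run_subphaseStart (hN : 0 < N) (l : ℕ) (h : ∀ l' < l, ¬ AllConfident T x l') :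
    run T x (subphaseStart N (l + 1)) = exploreWorld x l 0 := by
  induction l with
  | zero =>
    have : subphaseStart N 1 = 0 := by simp [subphaseStart]
    rw [this]
    simp [run, World.init, exploreWorld, obsState, LearnState.init, explorations]
  | succ l ih =>
    rw [run_subphase_end hN (ih fun l' hl' => h l' (by omega)), if_neg (h l (by omega))]

end Learning

/-! ### How the run depends on the rewards: causality and measurability. -/

section Dependence

variable {T : ℕ} {x x' : ℕ → Fin N → Fin N → ℝ}

theorem run_congr {n : ℕ} (h : ∀ t ≤ n, 1 ≤ t → x t = x' t) : run T x n = run T x' n := by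
  induction n with
  | zero => rfl
  | succ n ih => rw [run, run, ih fun t ht => h t (by omega), h (n + 1) le_rfl (by omega)]

/-- Outside phase 1 the memory update ignores the observed reward, so runs that agree once nobody is
learning agree for ever, whatever rewards follow. -/
theorem run_congr_of_trade {n n' : ℕ} (hn : n ≤ n') (h : run T x n = run T x' n)
    (hl : ∀ i s, (run T x n).player i ≠ .learn s) :
    run T x n' = run T x' n' ∧ ∀ i s, (run T x n').player i ≠ .learn s := by
  induction n', hn using Nat.le_induction with
  | base => exact ⟨h, hl⟩
  | succ n' _ ih =>
    obtain ⟨h1, h2⟩ := ih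
    have hstep : ∀ i (r r' : ℝ) (t : ℕ) F F' o app,
        ((run T x n').player i).next T i t F F' ⟨o, r, app⟩ =
          ((run T x n').player i).next T i t F F' ⟨o, r', app⟩ ∧
        ∀ s, ((run T x n').player i).next T i t F F' ⟨o, r, app⟩ ≠ .learn s := by
      intro i r r' t F F' o app
      have := h2 i
      cases hp : (run T x n').player i with
      | learn s => exact absurd hp (this s)
      | trade s =>
        refine ⟨rfl, fun s' => ?_⟩
        simp only [PlayerState.next, PlayerState.nextTrade]
        split_ifs <;> simp
      | settled a => exact ⟨rfl, fun s' => by simp [PlayerState.next]⟩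
    refine ⟨?_, fun i => (hstep i _ 0 _ _ _ _ _).2⟩
    rw [run, run, ← h1, World.next, World.next, World.mk.injEq]
    exact ⟨funext fun i => (hstep i _ _ _ _ _ _ _).1, rfl⟩

theorem le_subphaseStart (N l : ℕ) : l ≤ subphaseStart N (l + 1) := by
  have h1 := subphaseStart_add_two N l
  have h2 : l + 1 < 2 ^ (l + 1) := Nat.lt_two_pow_self
  omega

theorem subphaseStart_mono (N : ℕ) : Monotone fun l => subphaseStart N (l + 1) :=
  monotone_nat_of_le_succ fun l => (subphaseStart_succ N l).ge.trans' (Nat.le_add_right _ _)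

theorem exists_subphase (N n : ℕ) :
    ∃ l, subphaseStart N (l + 1) ≤ n ∧ n < subphaseStart N (l + 2) := by
  have hex : ∃ l, n < subphaseStart N (l + 2) :=
    ⟨n, (le_subphaseStart N (n + 1)).trans_lt' (Nat.lt_succ_self n)⟩
  refine ⟨Nat.find hex, ?_, Nat.find_spec hex⟩
  cases h : Nat.find hex with
  | zero => simp [subphaseStart]
  | succ l => exact not_lt.1 (Nat.find_min hex (by omega))

/-- The proposals depend on the rewards only through the rankings found in phase 1. -/
theorem proposals_congr (hN : 0 < N) {n : ℕ}
    (h : ∀ l ≤ n, ∀ i, foundRank T x l i = foundRank T x' l i) :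
    (run T x n).proposals (n + 1) = (run T x' n).proposals (n + 1) := by
  have hconf : ∀ l ≤ n, (AllConfident T x l ↔ AllConfident T x' l) := fun l hl => by
    simp only [AllConfident, h l hl]
  by_cases hex : ∃ l, AllConfident T x l ∧ subphaseStart N (l + 2) ≤ n
  · have hmin := fun l' (hl' : l' < Nat.find hex) => Nat.find_min hex hl'
    obtain ⟨h1, h2⟩ := Nat.find_spec hex
    set l := Nat.find hex
    have hln : l + 1 ≤ n := (le_subphaseStart N (l + 1)).trans h2
    have hnot : ∀ l' < l, ¬ AllConfident T x l' := fun l' hl' hc =>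
      hmin l' hl' ⟨hc, (subphaseStart_mono N (by omega : l' + 1 ≤ l + 1)).trans h2⟩
    have e1 := run_subphase_end hN (run_subphaseStart hN l hnot)
    have e2 := run_subphase_end hN (run_subphaseStart hN l fun l' hl' =>
      mt (hconf l' (by omega)).2 (hnot l' hl'))
    rw [if_pos h1] at e1
    rw [if_pos ((hconf l (by omega)).1 h1)] at e2
    have e3 : run T x (subphaseStart N (l + 2)) = run T x' (subphaseStart N (l + 2)) := by
      rw [e1, e2]; simp only [h l (by omega)]
    rw [(run_congr_of_trade h2 e3 (by rw [e1]; simp)).1]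
  · obtain ⟨l, hl1, hl2⟩ := exists_subphase N n
    have hln : l ≤ n := (le_subphaseStart N l).trans hl1
    have hnot : ∀ l' < l, ¬ AllConfident T x l' := fun l' hl' hc => hex
      ⟨l', hc, (subphaseStart_mono N (by omega : l' + 1 ≤ l)).trans hl1⟩
    have e1 := run_subphaseStart hN l hnot
    have e2 := run_subphaseStart hN l fun l' hl' =>
      mt (hconf l' (by omega)).2 (hnot l' hl')
    obtain ⟨k, rfl⟩ := Nat.exists_eq_add_of_le hl1
    funext i
    rcases Nat.lt_or_ge k (2 ^ (l + 1)) with hk | hk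
    · rw [run_explore e1 hk, run_explore e2 hk, exploreWorld_proposals hk,
        exploreWorld_proposals hk]
    · obtain ⟨c, rfl⟩ := Nat.exists_eq_add_of_le hk
      rw [subphaseStart_succ] at hl2
      have hc : c < N := by omega
      rw [← add_assoc, run_comm e1 hc, run_comm e2 hc, commWorld_proposals hc,
        commWorld_proposals hc, h l hln]

theorem measurable_est (l : ℕ) (i j : Fin N) (e : ℕ) :
    Measurable fun x : ℕ → Fin N → Fin N → ℝ => (obsState x l i e).est j := by
  simp only [obsState]
  fun_prop

/-- The proposals factor through finitely many measurable yes/no questions, namely which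
permutations separate the confidence intervals, so every event about them is the preimage of a
subset of a finite space. -/
theorem measurableSet_proposals (hN : 0 < N) (T n : ℕ)
    (S : Set (Fin N → Option (Fin N))) :
    MeasurableSet {x : ℕ → Fin N → Fin N → ℝ | (run T x n).proposals (n + 1) ∈ S} := by
  let K : (ℕ → Fin N → Fin N → ℝ) → Fin (n + 1) → Fin N → Equiv.Perm (Fin N) → Prop :=
    fun x l i σ => (obsState x (l + 1) i (2 ^ (l.val + 2) - 2)).Separates T σ
  have hK : Measurable K := by
    refine measurable_pi_iff.2 fun l => measurable_pi_iff.2 fun i => measurable_pi_iff.2 fun σ =>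
      measurableSet_setOfPred.1 ?_
    simp only [K, LearnState.Separates, Set.ofPred_forall]
    refine MeasurableSet.iInter fun k => MeasurableSet.iInter fun hk => ?_
    exact measurableSet_lt ((measurable_est _ _ _ _).add_const (radius T (explorations _ _ _).card))
      ((measurable_est _ _ _ _).sub_const (radius T (explorations _ _ _).card))
  have hinv : {x : ℕ → Fin N → Fin N → ℝ | (run T x n).proposals (n + 1) ∈ S} =
      K ⁻¹' (K '' {x | (run T x n).proposals (n + 1) ∈ S}) := by
    refine Set.Subset.antisymm (Set.subset_preimage_image _ _) fun x ⟨x', hx', he⟩ => ?_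
    have hc : (run T x n).proposals (n + 1) = (run T x' n).proposals (n + 1) := by
      refine proposals_congr hN fun l hl i => ?_
      -- `LearnState.findRank` picks a permutation by choice; the pick depends only on the
      -- predicate, so equal predicates give equal rankings.
      have hs : (obsState x (l + 1) i (2 ^ (l + 2) - 2)).Separates T =
          (obsState x' (l + 1) i (2 ^ (l + 2) - 2)).Separates T :=
        (congrFun (congrFun he ⟨l, by omega⟩) i).symm
      simp only [foundRank, LearnState.findRank, hs]
    rw [Set.mem_ofPred_eq, hc]
    exact hx'
  rw [hinv]
  exact hK (Set.toFinite _).measurableSet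

/-- The outcome of player `i` in round `n + 1`. -/
def outcome (T : ℕ) (x : ℕ → Fin N → Fin N → ℝ) (i : Fin N) (n : ℕ) : Option (Fin N) :=
  matched ((run T x n).proposals (n + 1)) i

theorem receivedReward_succ (i : Fin N) (n : ℕ) :
    receivedReward T x i (n + 1) =
      ∑ j, (if outcome T x i n = some j then 1 else 0) * x (n + 1) i j := by
  have : receivedReward T x i (n + 1) = (outcome T x i n).elim 0 (x (n + 1) i) := rfl
  rw [this]
  cases outcome T x i n <;> simp

theorem outcomeValue_eq_sum (U : Fin N → Fin N → ℝ) (i : Fin N) (o : Option (Fin N)) :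
    outcomeValue U i o = ∑ j, (if o = some j then 1 else 0) * U i j := by
  cases o <;> simp [outcomeValue]

theorem totalReward_eq {Ω : Type*} {ξ : ℕ → Fin N → Fin N → Ω → ℝ} (T : ℕ) (i : Fin N) (ω : Ω) : totalReward T ξ i ω =
    ∑ n ∈ Finset.range T, receivedReward T (fun t i j => ξ t i j ω) i (n + 1) := by
  rw [totalReward, Finset.range_eq_Ico, Finset.sum_Ico_add' (fun t => receivedReward T _ i t)]
  rfl

end Dependence

/-! ### The regret as an expected sum of per-round gaps. -/

section Expectation

variable {Ω : Type*} [MeasurableSpace Ω] {P : Measure Ω}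
  {U : Fin N → Fin N → ℝ} {ξ : ℕ → Fin N → Fin N → Ω → ℝ}

theorem IsRewardModel.integrable [IsProbabilityMeasure P] (h : IsRewardModel P U ξ) (t : ℕ) (i j : Fin N) :
    Integrable (ξ t i j) P := by
  refine ((h.subgaussian t i j).integrable.add (integrable_const (U i j))).congr ?_
  exact .of_forall fun ω => sub_add_cancel _ _

theorem IsRewardModel.measurable_table (h : IsRewardModel P U ξ) (t : ℕ) :
    Measurable fun ω i j => ξ t i j ω :=
  measurable_pi_iff.2 fun i => measurable_pi_iff.2 fun j => h.measurable t i j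

theorem IsRewardModel.measurable_tables (h : IsRewardModel P U ξ) :
    Measurable fun ω t i j => ξ t i j ω :=
  measurable_pi_iff.2 h.measurable_table

theorem measurable_indicator_outcome (hN : 0 < N) (T : ℕ) (i : Fin N) (n : ℕ) (j : Fin N) :
    Measurable fun x : ℕ → Fin N → Fin N → ℝ =>
      if outcome T x i n = some j then (1 : ℝ) else 0 :=
  Measurable.ite (measurableSet_proposals hN T n {A | matched A i = some j}) measurable_const
    measurable_const

/-- The outcome of a round is independent of the reward table of the round. -/
theorem IsRewardModel.indepFun_outcome [IsProbabilityMeasure P] (h : IsRewardModel P U ξ) (hN : 0 < N) (T : ℕ)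
    (i : Fin N) (n : ℕ) (j : Fin N) :
    IndepFun (fun ω => if outcome T (fun t i j => ξ t i j ω) i n = some j then (1 : ℝ) else 0)
      (ξ (n + 1) i j) P := by
  let S := Finset.range (n + 1)
  have hind := h.indep.indepFun_finset S {n + 1} (by simp [S]) h.measurable_table
  let ext : (S → Fin N → Fin N → ℝ) → ℕ → Fin N → Fin N → ℝ :=
    -- Tables of rounds after `n` are replaced by 0; `run_congr` shows that the outcome of round `n
    -- + 1` does not notice.
    fun y t => if ht : t ∈ S then y ⟨t, ht⟩ else 0
  have hext : Measurable ext := by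
    refine measurable_pi_iff.2 fun t => ?_
    by_cases ht : t ∈ S
    · simpa only [ext, dif_pos ht] using measurable_pi_apply _
    · simpa only [ext, dif_neg ht] using measurable_const
  have hev : Measurable fun y : (({n + 1} : Finset ℕ) → Fin N → Fin N → ℝ) =>
      y ⟨n + 1, by simp⟩ i j := by fun_prop
  have := hind.comp ((measurable_indicator_outcome hN T i n j).comp hext) hev
  convert this using 1
  · funext ω
    have ho : outcome T (fun t i j => ξ t i j ω) i n = outcome T (ext fun a i j => ξ a i j ω) i n := by
      simp only [outcome]
      congr 2
      refine run_congr fun t ht _ => ?_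
      have : t ∈ S := Finset.mem_range.2 (by omega)
      simp only [ext, dif_pos this]
    simp only [Function.comp, ho]
  · rfl

theorem IsRewardModel.integral_receivedReward [IsProbabilityMeasure P] (h : IsRewardModel P U ξ) (hN : 0 < N) (T : ℕ)
    (i : Fin N) (n : ℕ) :
    Integrable (fun ω => receivedReward T (fun t i j => ξ t i j ω) i (n + 1)) P ∧
    Integrable (fun ω => outcomeValue U i (outcome T (fun t i j => ξ t i j ω) i n)) P ∧
      ∫ ω, receivedReward T (fun t i j => ξ t i j ω) i (n + 1) ∂P =
        ∫ ω, outcomeValue U i (outcome T (fun t i j => ξ t i j ω) i n) ∂P := by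
  have hm := fun j => (measurable_indicator_outcome hN T i n j).comp h.measurable_tables
  have hi : ∀ j, Integrable (fun ω =>
      if outcome T (fun t i j => ξ t i j ω) i n = some j then (1 : ℝ) else 0) P := fun j =>
    Integrable.of_bound (hm j).aestronglyMeasurable 1 (.of_forall fun ω => by
      split_ifs <;> simp)
  have h1 : ∀ j, Integrable (fun ω =>
      (if outcome T (fun t i j => ξ t i j ω) i n = some j then (1 : ℝ) else 0) *
        ξ (n + 1) i j ω) P := fun j =>
    (h.indepFun_outcome hN T i n j).integrable_mul (hi j) (h.integrable _ _ _)
  have h2 : ∀ j, Integrable (fun ω =>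
      (if outcome T (fun t i j => ξ t i j ω) i n = some j then (1 : ℝ) else 0) * U i j) P :=
    fun j => (hi j).mul_const _
  simp only [receivedReward_succ, outcomeValue_eq_sum]
  refine ⟨integrable_finsetSum _ fun j _ => h1 j, integrable_finsetSum _ fun j _ => h2 j, ?_⟩
  rw [integral_finsetSum _ fun j _ => h1 j, integral_finsetSum _ fun j _ => h2 j]
  refine Finset.sum_congr rfl fun j _ => ?_
  rw [(h.indepFun_outcome hN T i n j).integral_fun_mul_eq_mul_integral
    (hi j).aestronglyMeasurable (h.integrable _ _ _).aestronglyMeasurable, h.mean,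
    integral_mul_const]

theorem IsRewardModel.integrable_totalReward [IsProbabilityMeasure P] (h : IsRewardModel P U ξ) (hN : 0 < N) (T : ℕ)
    (i : Fin N) : Integrable (totalReward T ξ i) P := by
  have : totalReward T ξ i = fun ω => ∑ n ∈ Finset.range T,
      receivedReward T (fun t i j => ξ t i j ω) i (n + 1) := funext (totalReward_eq T i)
  rw [this]
  exact integrable_finsetSum _ fun n _ => (h.integral_receivedReward hN T i n).1

/-- The core regret is the expectation of the sum of the per-round gaps. -/
theorem IsRewardModel.coreRegret_eq [IsProbabilityMeasure P] (h : IsRewardModel P U ξ) (hN : 0 < N) (T : ℕ)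
    (μ : Equiv.Perm (Fin N)) (i : Fin N) :
    Integrable (fun ω => ∑ n ∈ Finset.range T,
      (U i (μ i) - outcomeValue U i (outcome T (fun t i j => ξ t i j ω) i n))) P ∧
    coreRegret P T U μ ξ i = ∫ ω, ∑ n ∈ Finset.range T,
      (U i (μ i) - outcomeValue U i (outcome T (fun t i j => ξ t i j ω) i n)) ∂P := by
  have hn := fun n => h.integral_receivedReward hN T i n
  have hint : ∀ n, Integrable (fun ω =>
      U i (μ i) - outcomeValue U i (outcome T (fun t i j => ξ t i j ω) i n)) P :=
    fun n => (integrable_const _).sub (hn n).2.1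
  refine ⟨integrable_finsetSum _ fun n _ => hint n, ?_⟩
  simp only [coreRegret, totalReward_eq]
  rw [integral_finsetSum _ fun n _ => (hn n).1, integral_finsetSum _ fun n _ => hint n]
  simp only [integral_sub (integrable_const _) (hn _).2.1, (hn _).2.2, Finset.sum_sub_distrib]
  simp

end Expectation

/-! ### The minimum gap and the maximum one-round regret. -/

section Gaps

variable {U : Fin N → Fin N → ℝ}

theorem minGap_le (hinj : ∀ i, Function.Injective (U i)) (i : Fin N) (k : ℕ) (hk : k + 1 < N) :
    minGap U ≤ U i (prefRank U i ⟨k, Nat.lt_of_succ_lt hk⟩) - U i (prefRank U i ⟨k + 1, hk⟩) := by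
  refine csInf_le ⟨0, ?_⟩ ⟨i, k, hk, rfl⟩
  rintro g ⟨i, k, hk, rfl⟩
  exact sub_nonneg.2 ((strictAnti_prefRank hinj i).antitone (by simp [Fin.le_def]))

theorem minGap_pos (hN : 2 ≤ N) (hinj : ∀ i, Function.Injective (U i)) : 0 < minGap U := by
  set S := {g | ∃ (i : Fin N) (k : ℕ) (hk : k + 1 < N),
    g = U i (prefRank U i ⟨k, Nat.lt_of_succ_lt hk⟩) - U i (prefRank U i ⟨k + 1, hk⟩)} with hS
  have hfin : S.Finite := by
    refine ((Set.finite_range fun q : Fin N × Fin N × Fin N => U q.1 q.2.1 - U q.1 q.2.2)).subset ?_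
    rintro g ⟨i, k, hk, rfl⟩
    exact ⟨(i, _, _), rfl⟩
  have hne : S.Nonempty := ⟨_, ⟨0, by omega⟩, 0, by omega, rfl⟩
  obtain ⟨i, k, hk, h⟩ := hne.csInf_mem hfin
  change 0 < sInf S
  rw [h]
  exact sub_pos.2 (strictAnti_prefRank hinj i (by simp [Fin.lt_def]))

/-- The `N - 1` consecutive gaps of one player add up to at most the length of `[0, 1]`. This is
what lets `N ^ 2` terms be absorbed by `1 / minGap U ^ 2`. -/
theorem minGap_mul_le (hN : 2 ≤ N) (hinj : ∀ i, Function.Injective (U i))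
    (hU : ∀ i j, U i j ∈ Set.Icc (0 : ℝ) 1) : minGap U * (N - 1) ≤ 1 := by
  let i : Fin N := ⟨0, by omega⟩
  have key : ∀ k (hk : k < N),
      minGap U * k ≤ U i (prefRank U i ⟨0, by omega⟩) - U i (prefRank U i ⟨k, hk⟩) := by
    intro k
    induction k with
    | zero => intro; simp
    | succ k ih =>
      intro hk
      have h1 := ih (by omega)
      have h2 := minGap_le hinj i k hk
      push_cast
      linarith
  have h := key (N - 1) (by omega)
  rw [Nat.cast_sub (by omega), Nat.cast_one] at h
  have h1 := (hU i (prefRank U i ⟨0, by omega⟩)).2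
  have h2 := (hU i (prefRank U i ⟨N - 1, by omega⟩)).1
  linarith

theorem le_maxGap (μ : Equiv.Perm (Fin N)) (i : Fin N) (o : Option (Fin N)) :
    U i (μ i) - outcomeValue U i o ≤ maxGap U μ i :=
  Finset.le_sup' (fun o : Option (Fin N) => U i (μ i) - outcomeValue U i o) (Finset.mem_univ o)

theorem maxGap_nonneg (μ : Equiv.Perm (Fin N)) (i : Fin N) : 0 ≤ maxGap U μ i := by
  simpa [outcomeValue] using le_maxGap (U := U) μ i (some (μ i))

theorem maxGap_le_one (hU : ∀ i j, U i j ∈ Set.Icc (0 : ℝ) 1) (μ : Equiv.Perm (Fin N))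
    (i : Fin N) : maxGap U μ i ≤ 1 := by
  refine Finset.sup'_le _ _ fun o _ => ?_
  have h1 := (hU i (μ i)).2
  cases o with
  | none => simpa [outcomeValue] using h1
  | some j => have := (hU i j).1; simp only [outcomeValue, Option.elim]; linarith

end Gaps

/-! ### Correct confidence intervals yield the true rankings. -/

section Confidence

variable {T : ℕ} {x : ℕ → Fin N → Fin N → ℝ} {U : Fin N → Fin N → ℝ}

/-- The confidence intervals at the end of the exploration of sub-phase `l + 1` are correct. -/
def Accurate (T : ℕ) (U : Fin N → Fin N → ℝ) (x : ℕ → Fin N → Fin N → ℝ) (l : ℕ) : Prop :=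
  ∀ i j, |(obsState x (l + 1) i (2 ^ (l + 2) - 2)).est j - U i j| <
    radius T ((obsState x (l + 1) i (2 ^ (l + 2) - 2)).cnt j)

theorem eq_prefRank_of_found (hinj : ∀ i, Function.Injective (U i)) {l : ℕ}
    (hacc : Accurate T U x l) {i : Fin N} {σ : Equiv.Perm (Fin N)}
    (h : foundRank T x l i = some σ) : σ = prefRank U i := by
  have hsep : (obsState x (l + 1) i (2 ^ (l + 2) - 2)).Separates T σ := by
    simp only [foundRank, LearnState.findRank] at h
    split_ifs at h with hex
    rw [← Option.some_injective _ h]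
    exact hex.choose_spec
  set s := obsState x (l + 1) i (2 ^ (l + 2) - 2)
  refine eq_prefRank hinj i ?_
  obtain ⟨n, rfl⟩ : ∃ n, N = n + 1 := ⟨N - 1, by have := i.2; omega⟩
  refine Fin.strictAnti_iff_succ_lt.2 fun k => ?_
  have h1 : s.est (σ k.succ) + radius T (s.cnt (σ k.succ)) <
    s.est (σ k.castSucc) - radius T (s.cnt (σ k.castSucc)) := hsep k.val (by omega)
  have h2 := abs_lt.1 (hacc i (σ k.castSucc))
  have h3 := abs_lt.1 (hacc i (σ k.succ))
  change U i (σ k.succ) < U i (σ k.castSucc)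
  linarith [h2.1, h3.2]

/-- Between consecutive arms, two estimation errors and two radii, each at most a quarter of the gap
and the errors strictly less, cannot close a gap of `minGap U`. -/
theorem allConfident_of_accurate (hinj : ∀ i, Function.Injective (U i)) {l : ℕ}
    (hacc : Accurate T U x l)
    (hr : ∀ i j, radius T ((obsState x (l + 1) i (2 ^ (l + 2) - 2)).cnt j) ≤ minGap U / 4) :
    AllConfident T x l := by
  intro i
  have hsep : (obsState x (l + 1) i (2 ^ (l + 2) - 2)).Separates T (prefRank U i) := by
    intro k hk
    have h0 := minGap_le hinj i k hk
    have h1 := abs_lt.1 (hacc i (prefRank U i ⟨k, Nat.lt_of_succ_lt hk⟩))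
    have h2 := abs_lt.1 (hacc i (prefRank U i ⟨k + 1, hk⟩))
    have h3 := hr i (prefRank U i ⟨k, Nat.lt_of_succ_lt hk⟩)
    have h4 := hr i (prefRank U i ⟨k + 1, hk⟩)
    simp only [LearnState.ucb, LearnState.lcb]
    linarith [h1.1, h1.2, h2.1, h2.2]
  simp only [foundRank, LearnState.findRank]
  rw [dif_pos ⟨_, hsep⟩]
  rfl

/-- The explorations of a given arm form one residue class modulo `N`. -/
theorem div_le_card_explorations (i j : Fin N) (e : ℕ) : e / N ≤ (explorations i j e).card := by
  have h := Nat.count_modEq_card e i.pos (j.val + (N - (i.val + 1)))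
  rw [Nat.count_eq_card_filter_range] at h
  have he : explorations i j e =
      (Finset.range e).filter fun a => a ≡ j.val + (N - (i.val + 1)) [MOD N] := by
    refine Finset.filter_congr fun a _ => ?_
    have hi : i.val + 1 ≤ N := i.2
    have h1 : exploreArm i a = j ↔ a + (i.val + 1) ≡ j.val + N [MOD N] := by
      rw [Fin.ext_iff, exploreArm, Nat.ModEq, Nat.add_mod_right, Nat.mod_eq_of_lt j.2]
      ring_nf
    have h2 : j.val + N = j.val + (N - (i.val + 1)) + (i.val + 1) := by omega
    rw [h1, h2]
    exact ⟨fun h => Nat.ModEq.add_right_cancel' _ h, fun h => h.add_right _⟩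
  rw [he, h]
  exact Nat.le_add_right _ _

theorem log_cast_pos (hT : 2 ≤ T) : 0 < Real.log T :=
  Real.log_pos (by exact_mod_cast hT)

theorem two_thirds_le_log (hT : 2 ≤ T) : (0.69 : ℝ) ≤ Real.log T := by
  have h1 : Real.log 2 ≤ Real.log T := Real.log_le_log (by norm_num) (by exact_mod_cast hT)
  linarith [Real.log_two_gt_d9]

/-- The constant is `96 = 6 * 4 ^ 2`: it solves `6 * log T / M = (δ / 4) ^ 2`. -/
theorem radius_le {M δ : ℝ} (hδ : 0 < δ) (hT : 2 ≤ T) (hM : M = 96 * Real.log T / δ ^ 2) {n : ℕ}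
    (hn : M ≤ n) : radius T n ≤ δ / 4 := by
  have hlog := log_cast_pos hT
  have hMpos : 0 < M := by rw [hM]; positivity
  rw [radius, Real.sqrt_le_left (by positivity), div_le_iff₀ (by positivity)]
  have h1 : 6 * Real.log T = (δ / 4) ^ 2 * M := by
    rw [hM]; field_simp; norm_num
  rw [h1]
  exact mul_le_mul_of_nonneg_left (hn.trans (le_max_left _ _)) (by positivity)

end Confidence

/-! ### Tail bounds for the estimates. -/

section Concentration

variable {Ω : Type*} [MeasurableSpace Ω] {P : Measure Ω}
  {T : ℕ} {U : Fin N → Fin N → ℝ} {ξ : ℕ → Fin N → Fin N → Ω → ℝ}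

theorem IsRewardModel.measure_inaccurate_le [IsProbabilityMeasure P] (h : IsRewardModel P U ξ)
    (hT : 2 ≤ T)
    (hU : ∀ i j, U i j ∈ Set.Icc (0 : ℝ) 1) (l : ℕ) (i j : Fin N) (e : ℕ) :
    P.real {ω | radius T ((obsState (fun t i j => ξ t i j ω) l i e).cnt j) ≤
      |(obsState (fun t i j => ξ t i j ω) l i e).est j - U i j|} ≤ 2 * ((T : ℝ) ^ 3)⁻¹ := by
  have hlog := two_thirds_le_log hT
  have hTpos : (0 : ℝ) < T := by exact_mod_cast (by omega : 0 < T)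
  simp only [obsState]
  set s := explorations i j e with hs
  -- The sample set `s` does not depend on `ω`, so no stopping argument is needed. Without
  -- observations the interval has radius `√(6 log T) > 1` around 0 and contains every utility.
  rcases Nat.eq_zero_or_pos s.card with h0 | hpos
  · have hempty : {ω : Ω | radius T s.card ≤
        |(∑ e' ∈ s, ξ (exploreTime N e') i j ω) / (s.card : ℝ) - U i j|} = ∅ := by
      refine Set.eq_empty_of_forall_notMem fun ω hω => ?_
      have hω' : radius T s.card ≤
        |(∑ e' ∈ s, ξ (exploreTime N e') i j ω) / (s.card : ℝ) - U i j| := hω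
      simp only [h0, Nat.cast_zero, div_zero, zero_sub, abs_neg, radius] at hω'
      rw [max_eq_right zero_le_one, div_one, abs_of_nonneg (hU i j).1] at hω'
      have h1 := hω'.trans (hU i j).2
      rw [Real.sqrt_le_left (by norm_num)] at h1
      linarith
    rw [hempty, measureReal_empty]
    positivity
  have hc : (0 : ℝ) < s.card := by exact_mod_cast hpos
  have hc1 : (1 : ℝ) ≤ s.card := by exact_mod_cast hpos
  have hr : radius T s.card ^ 2 = 6 * Real.log T / s.card := by
    rw [radius, Real.sq_sqrt (by positivity), max_eq_left hc1]
  have hr0 : 0 ≤ radius T s.card := Real.sqrt_nonneg _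
  let X : ℕ → Ω → ℝ := fun e' ω => ξ (exploreTime N e') i j ω - U i j
  have hX : iIndepFun X P :=
    (h.indep.precomp (exploreTime_strictMono N).injective).comp
      (fun _ (y : Fin N → Fin N → ℝ) => y i j - U i j) fun _ => by fun_prop
  have hsub := HasSubgaussianMGF.sum_of_iIndepFun hX (c := fun _ => 1) (s := s)
    fun e' _ => h.subgaussian _ i j
  -- With `n` samples and radius `r`, the exponent is `n * r ^ 2 / 2 = 3 * log T`; this is what the
  -- 6 in `radius` is for.
  have hexp : Real.exp (-(s.card * radius T s.card) ^ 2 / (2 * ((∑ _ ∈ s, 1 : NNReal) : ℝ))) =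
      ((T : ℝ) ^ 3)⁻¹ := by
    have : -(s.card * radius T s.card) ^ 2 / (2 * ((∑ _ ∈ s, 1 : NNReal) : ℝ)) =
        -(3 * Real.log T) := by
      rw [mul_pow, hr]
      simp
      field_simp
      norm_num
    rw [this, Real.exp_neg, mul_comm, Real.exp_mul, Real.exp_log hTpos]
    norm_cast
  have h1 := hsub.measure_ge_le (ε := s.card * radius T s.card) (by positivity)
  have h2 := hsub.neg.measure_ge_le (ε := s.card * radius T s.card) (by positivity)
  rw [hexp] at h1 h2
  have hcover : {ω : Ω | radius T s.card ≤
      |(∑ e' ∈ s, ξ (exploreTime N e') i j ω) / (s.card : ℝ) - U i j|} ⊆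
      {ω | s.card * radius T s.card ≤ ∑ e' ∈ s, X e' ω} ∪
      {ω | s.card * radius T s.card ≤ (-fun ω => ∑ e' ∈ s, X e' ω) ω} := by
    intro ω hω
    have hω' : radius T s.card ≤
        |(∑ e' ∈ s, ξ (exploreTime N e') i j ω) / (s.card : ℝ) - U i j| := hω
    have hsum : ∑ e' ∈ s, X e' ω =
        s.card * ((∑ e' ∈ s, ξ (exploreTime N e') i j ω) / (s.card : ℝ) - U i j) := by
      simp only [X, Finset.sum_sub_distrib, Finset.sum_const, nsmul_eq_mul]
      field_simp
    rcases le_abs.1 hω' with h | h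
    · left
      change _ ≤ ∑ e' ∈ s, X e' ω
      rw [hsum]
      exact mul_le_mul_of_nonneg_left h hc.le
    · right
      change _ ≤ -∑ e' ∈ s, X e' ω
      rw [hsum, ← mul_neg]
      exact mul_le_mul_of_nonneg_left h hc.le
  calc _ ≤ _ := measureReal_mono hcover
    _ ≤ _ := measureReal_union_le _ _
    _ ≤ _ := by linarith

theorem measurableSet_accurate (h : IsRewardModel P U ξ) (l : ℕ) :
    MeasurableSet {ω | Accurate T U (fun t i j => ξ t i j ω) l} := by
  simp only [Accurate, Set.ofPred_forall]
  refine MeasurableSet.iInter fun i => MeasurableSet.iInter fun j => ?_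
  refine measurableSet_lt ?_ (measurable_const (a := radius T (explorations i j _).card))
  exact (((measurable_est _ _ _ _).comp h.measurable_tables).sub_const _).abs

theorem IsRewardModel.measure_not_accurate_le [IsProbabilityMeasure P] (h : IsRewardModel P U ξ)
    (hT : 2 ≤ T)
    (hU : ∀ i j, U i j ∈ Set.Icc (0 : ℝ) 1) (L : ℕ) :
    P.real {ω | ¬ ∀ l < L, Accurate T U (fun t i j => ξ t i j ω) l} ≤
      L * N ^ 2 * (2 * ((T : ℝ) ^ 3)⁻¹) := by
  let S := Finset.range L ×ˢ (Finset.univ : Finset (Fin N × Fin N))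
  have hsub : {ω | ¬ ∀ l < L, Accurate T U (fun t i j => ξ t i j ω) l} ⊆ ⋃ q ∈ S,
      {ω | radius T ((obsState (fun t i j => ξ t i j ω) (q.1 + 1) q.2.1
          (2 ^ (q.1 + 2) - 2)).cnt q.2.2) ≤
        |(obsState (fun t i j => ξ t i j ω) (q.1 + 1) q.2.1 (2 ^ (q.1 + 2) - 2)).est q.2.2 -
          U q.2.1 q.2.2|} := by
    intro ω hω
    have hω' : ¬ ∀ l < L, Accurate T U (fun t i j => ξ t i j ω) l := hω
    simp only [Accurate] at hω'
    push Not at hω'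
    obtain ⟨l, hl, i, j, hij⟩ := hω'
    exact Set.mem_biUnion (x := (l, i, j)) (by simp [S, hl]) hij
  calc _ ≤ _ := measureReal_mono hsub (measure_ne_top _ _)
    _ ≤ _ := measureReal_biUnion_finset_le _ _
    _ ≤ ∑ _q ∈ S, 2 * ((T : ℝ) ^ 3)⁻¹ :=
      Finset.sum_le_sum fun q _ => h.measure_inaccurate_le hT hU _ _ _ _
    _ = _ := by
      rw [Finset.sum_const, nsmul_eq_mul]
      simp only [S, Finset.card_product, Finset.card_range, Finset.card_univ, Fintype.card_prod,
        Fintype.card_fin]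
      push_cast
      ring

end Concentration

/-! ### Counting the rounds in which the core arm is missed. -/

section Counting

variable {T : ℕ} {x : ℕ → Fin N → Fin N → ℝ} {U : Fin N → Fin N → ℝ} {μ : Equiv.Perm (Fin N)}

theorem outcome_exploreTime (hN : 0 < N) {l : ℕ} (h : ∀ l' < l, ¬ AllConfident T x l') {e : ℕ}
    (he : e < 2 ^ (l + 2) - 2) (i : Fin N) :
    outcome T x i (exploreTime N e - 1) = some (exploreArm i e) := by
  obtain ⟨m, hm⟩ : ∃ m, Nat.log 2 (e + 2) = m + 1 :=
    ⟨Nat.log 2 (e + 2) - 1, by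
      have := Nat.log_pos (b := 2) one_lt_two (by omega : 2 ≤ e + 2); omega⟩
  have h1 : 2 ^ (m + 1) ≤ e + 2 := hm ▸ Nat.pow_log_le_self 2 (by omega)
  have h2 : e + 2 < 2 ^ (m + 2) := by
    have := Nat.lt_pow_succ_log_self one_lt_two (e + 2)
    rwa [hm] at this
  have hml : m ≤ l := by
    by_contra hlt
    have := Nat.pow_le_pow_right (n := 2) two_pos (by omega : l + 2 ≤ m + 1)
    omega
  have h3 := two_le_two_pow_succ m
  have h4 : 2 ^ (m + 2) = 2 * 2 ^ (m + 1) := by rw [pow_succ 2 (m + 1), mul_comm]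
  obtain ⟨k, hk⟩ := Nat.exists_eq_add_of_le (by omega : 2 ^ (m + 1) - 2 ≤ e)
  have hk' : k < 2 ^ (m + 1) := by omega
  subst hk
  rw [exploreTime_eq hk', Nat.add_sub_cancel, outcome,
    run_explore (run_subphaseStart hN m fun l' hl' => h l' (by omega)) hk']
  exact matched_of_injective (exploreArm_injective _) (exploreWorld_proposals hk') i

/-- Bound on the number of rounds in which a player misses its arm in the core matching, when
the confidence intervals are correct up to a sub-phase in which all players are confident. -/
theorem card_missed_le (hN : 0 < N) (hinj : ∀ i, Function.Injective (U i))
    (hμ : IsCoreMatching U μ) {L : ℕ} (hacc : ∀ l ≤ L, Accurate T U x l)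
    (hconf : AllConfident T x L) (i : Fin N) (n : ℕ) :
    2 * (((Finset.range n).filter fun t => outcome T x i t ≠ some (μ i)).card +
        (2 ^ (L + 2) - 2) / N) ≤
      2 * (2 ^ (L + 2) - 2 + N * (L + 1)) + N * (N + 1) := by
  have hex : ∃ l, AllConfident T x l := ⟨L, hconf⟩
  have hmin := fun l' (hl' : l' < Nat.find hex) => Nat.find_min hex hl'
  have hl := Nat.find_spec hex
  have hlL : Nat.find hex ≤ L := Nat.find_min' hex hconf
  set l := Nat.find hex
  have hK : 2 * (N * (N + 1) / 2) = N * (N + 1) :=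
    Nat.mul_div_cancel' (Nat.even_mul_succ_self N).two_dvd
  set K := N * (N + 1) / 2
  have hrun : run T x (subphaseStart N (l + 2)) =
      ⟨fun i => .trade (TradeState.init (prefRank U i)), Finset.univ⟩ := by
    rw [run_subphase_end hN (run_subphaseStart hN l hmin), if_pos hl]
    congr 1
    funext i
    obtain ⟨σ, hσ⟩ := Option.isSome_iff_exists.1 (hl i)
    rw [hσ, eq_prefRank_of_found hinj (hacc l hlL) hσ]
    rfl
  have hset := allSettled_of_init hN hinj hμ hrun hK.ge
  have hend : ∀ t, subphaseStart N (l + 2) + K ≤ t → outcome T x i t = some (μ i) := fun t ht =>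
    matched_of_injective μ.injective (fun i => (hset.run ht).proposals (t + 1) i) i
  have hstart : subphaseStart N (l + 2) + 2 = 2 ^ (l + 2) + N * (l + 1) :=
    subphaseStart_add_two N (l + 1)
  have hpow : ∀ m, 2 ^ (m + 2) = 2 * 2 ^ (m + 1) := fun m => by rw [pow_succ 2 (m + 1), mul_comm]
  have htwo := two_le_two_pow_succ l
  have hp2 := hpow l
  -- Exploration rounds in which player `i` is matched to its core arm. The shift by one is due to
  -- `outcome` being indexed by the number of rounds before.
  let hits := (explorations i (μ i) (2 ^ (l + 2) - 2)).image fun e => exploreTime N e - 1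
  have hinjT : Function.Injective fun e => exploreTime N e - 1 := fun a b hab => by
    refine (exploreTime_strictMono N).injective ?_
    have h1 : 1 ≤ exploreTime N a := by unfold exploreTime; omega
    have h2 : 1 ≤ exploreTime N b := by unfold exploreTime; omega
    have : exploreTime N a - 1 = exploreTime N b - 1 := hab
    omega
  have hcard : hits.card = (explorations i (μ i) (2 ^ (l + 2) - 2)).card :=
    Finset.card_image_of_injective _ hinjT
  have hhits : hits ⊆ Finset.range (subphaseStart N (l + 2) + K) := by
    intro t ht
    obtain ⟨e, he, rfl⟩ := Finset.mem_image.1 ht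
    have he' := Finset.mem_range.1 (Finset.mem_filter.1 he).1
    have hmono := (exploreTime_strictMono N).monotone (by omega : e ≤ 2 ^ (l + 2) - 3)
    have hlast : 2 ^ (l + 2) - 3 = 2 ^ (l + 1) - 2 + (2 ^ (l + 1) - 1) := by omega
    rw [hlast, exploreTime_eq (by omega)] at hmono
    rw [Finset.mem_range, subphaseStart_succ]
    omega
  have hsub : ((Finset.range n).filter fun t => outcome T x i t ≠ some (μ i)) ⊆
      Finset.range (subphaseStart N (l + 2) + K) \ hits := by
    intro t ht
    have ht' := (Finset.mem_filter.1 ht).2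
    refine Finset.mem_sdiff.2 ⟨Finset.mem_range.2 (not_le.1 fun h => ht' (hend t h)), fun h => ?_⟩
    obtain ⟨e, he, rfl⟩ := Finset.mem_image.1 h
    obtain ⟨he1, he2⟩ := Finset.mem_filter.1 he
    exact ht' (by rw [outcome_exploreTime hN hmin (Finset.mem_range.1 he1), he2])
  have h1 := Finset.card_le_card hsub
  rw [Finset.card_sdiff_of_subset hhits, Finset.card_range, hcard] at h1
  have h2 := div_le_card_explorations i (μ i) (2 ^ (l + 2) - 2)
  have h3 := Finset.card_le_card hhits
  rw [Finset.card_range, hcard] at h3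
  have h4 : N * (l + 1) ≤ N * (L + 1) := Nat.mul_le_mul_left _ (by omega)
  have h5 : 2 ^ (l + 2) ≤ 2 ^ (L + 2) := Nat.pow_le_pow_right two_pos (by omega)
  obtain ⟨d, hd⟩ := Nat.exists_eq_add_of_le (Nat.sub_le_sub_right h5 2)
  -- The players may all be confident already in an earlier sub-phase `l`. The bound is monotone in
  -- the sub-phase: `d` further explorations add at most `d` to the subtracted quotient.
  have h6 : (2 ^ (L + 2) - 2) / N ≤ (2 ^ (l + 2) - 2) / N + d := by
    rw [hd]
    calc _ ≤ (2 ^ (l + 2) - 2 + N * d) / N :=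
          Nat.div_le_div_right (Nat.add_le_add_left (Nat.le_mul_of_pos_left d hN) _)
      _ = _ := Nat.add_mul_div_left _ _ hN
  omega

theorem sum_gap_le (i : Fin N) (n : ℕ) :
    ∑ t ∈ Finset.range n, (U i (μ i) - outcomeValue U i (outcome T x i t)) ≤
      ((Finset.range n).filter fun t => outcome T x i t ≠ some (μ i)).card * maxGap U μ i := by
  rw [← nsmul_eq_mul, ← Finset.sum_const, Finset.sum_filter]
  refine Finset.sum_le_sum fun t _ => ?_
  split_ifs with h
  · exact le_maxGap μ i _
  · rw [not_ne_iff] at h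
    simp [h, outcomeValue]

theorem sum_gap_le_mul (i : Fin N) (n : ℕ) :
    ∑ t ∈ Finset.range n, (U i (μ i) - outcomeValue U i (outcome T x i t)) ≤
      n * maxGap U μ i := by
  refine (sum_gap_le i n).trans (mul_le_mul_of_nonneg_right ?_ (maxGap_nonneg μ i))
  exact_mod_cast (Finset.card_filter_le _ _).trans (Finset.card_range n).le

end Counting

/-! ### From correct confidence intervals to expected regret. -/

section Regret

variable {Ω : Type*} [MeasurableSpace Ω] {P : Measure Ω} [IsProbabilityMeasure P]
  {T : ℕ} {U : Fin N → Fin N → ℝ} {ξ : ℕ → Fin N → Fin N → Ω → ℝ} {μ : Equiv.Perm (Fin N)}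

theorem IsRewardModel.coreRegret_le_horizon (h : IsRewardModel P U ξ) (hN : 0 < N)
    (i : Fin N) : coreRegret P T U μ ξ i ≤ T * maxGap U μ i := by
  obtain ⟨h1, h2⟩ := h.coreRegret_eq hN T μ i
  rw [h2]
  refine (integral_mono h1 (integrable_const (T * maxGap U μ i)) fun ω =>
    sum_gap_le_mul i T).trans ?_
  simp

/-- The regret bound in terms of a sub-phase in which correct confidence intervals are
separated. -/
theorem IsRewardModel.coreRegret_le_of_separated (h : IsRewardModel P U ξ) (hN : 0 < N)
    (hT : 2 ≤ T) (hU : ∀ i j, U i j ∈ Set.Icc (0 : ℝ) 1) (hinj : ∀ i, Function.Injective (U i))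
    (hμ : IsCoreMatching U μ) {L : ℕ} (hLT : L + 1 ≤ T)
    (hr : ∀ m, (2 ^ (L + 2) - 2) / N ≤ m → radius T m ≤ minGap U / 4) (i : Fin N) :
    coreRegret P T U μ ξ i ≤ ((2 ^ (L + 2) - 2 : ℕ) + N * (L + 1) + N * (N + 1) / 2 -
      ((2 ^ (L + 2) - 2) / N : ℕ) + N ^ 2) * maxGap U μ i := by
  obtain ⟨h1, h2⟩ := h.coreRegret_eq hN T μ i
  have hG := maxGap_nonneg (U := U) μ i
  set c : ℝ := (2 ^ (L + 2) - 2 : ℕ) + N * (L + 1) + N * (N + 1) / 2 -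
      ((2 ^ (L + 2) - 2) / N : ℕ) with hc
  let B : Set Ω := {ω | ¬ ∀ l < L + 1, Accurate T U (fun t i j => ξ t i j ω) l}
  have hB : MeasurableSet B := by
    refine MeasurableSet.compl (s := {ω | ∀ l < L + 1, Accurate T U (fun t i j => ξ t i j ω) l}) ?_
    simp only [Set.ofPred_forall]
    exact MeasurableSet.iInter fun l => MeasurableSet.iInter fun _ => measurableSet_accurate h l
  have hc0 : 0 ≤ c := by
    have : ((2 ^ (L + 2) - 2) / N : ℕ) ≤ ((2 ^ (L + 2) - 2 : ℕ) : ℝ) := by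
      exact_mod_cast Nat.div_le_self _ _
    have h3 : (0 : ℝ) ≤ N * (L + 1) + N * (N + 1) / 2 := by positivity
    linarith
  have hpt : ∀ ω, ∑ n ∈ Finset.range T,
      (U i (μ i) - outcomeValue U i (outcome T (fun t i j => ξ t i j ω) i n)) ≤
      c * maxGap U μ i + B.indicator (fun _ => T * maxGap U μ i) ω := by
    intro ω
    by_cases hω : ω ∈ B
    · rw [Set.indicator_of_mem hω]
      exact (sum_gap_le_mul i T).trans (le_add_of_nonneg_left (mul_nonneg hc0 hG))
    · rw [Set.indicator_of_notMem hω, add_zero]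
      have hacc : ∀ l < L + 1, Accurate T U (fun t i j => ξ t i j ω) l := not_not.1 hω
      have hconf := allConfident_of_accurate hinj (hacc L (by omega)) fun i j =>
        hr _ (div_le_card_explorations i j _)
      have hcount := card_missed_le hN hinj hμ (fun l hl => hacc l (by omega)) hconf i T
      refine (sum_gap_le i T).trans (mul_le_mul_of_nonneg_right ?_ hG)
      have hcount' := (Nat.cast_le (α := ℝ)).2 hcount
      simp only [Nat.cast_add, Nat.cast_mul, Nat.cast_ofNat, Nat.cast_one] at hcount'
      rw [hc]
      linarith
  -- The union bound gives `(L + 1) * N ^ 2 * 2 / T ^ 3`; both `L + 1` and the factor 2 are at most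
  -- `T`.
  have hPB : T * P.real B ≤ N ^ 2 := by
    have h3 := h.measure_not_accurate_le hT hU (L + 1)
    have hT' : (2 : ℝ) ≤ T := by exact_mod_cast hT
    have hL' : ((L + 1 : ℕ) : ℝ) ≤ T := by exact_mod_cast hLT
    calc T * P.real B ≤ T * (((L + 1 : ℕ) : ℝ) * N ^ 2 * (2 * ((T : ℝ) ^ 3)⁻¹)) := by gcongr
      _ ≤ T * (T * N ^ 2 * (T * ((T : ℝ) ^ 3)⁻¹)) := by gcongr
      _ = N ^ 2 := by field_simp
  have hind : Integrable (B.indicator fun _ => T * maxGap U μ i) P :=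
    (integrable_const _).indicator hB
  rw [h2]
  refine (integral_mono h1 ((integrable_const (c * maxGap U μ i)).add hind) hpt).trans ?_
  simp only [Pi.add_apply]
  rw [integral_add (integrable_const _) hind, integral_indicator_const _ hB]
  simp only [integral_const, probReal_univ, smul_eq_mul]
  nlinarith

end Regret

/-! ### Choice of the sub-phase and comparison with the explicit bound. -/

section Arithmetic

/-- From `log (2 * N) ≤ 2 * N`, `log M ≤ 2 * √M` and `4 * N ≤ √M`, the left side is at most `M / 8 +
M / 2`. -/
theorem cast_mul_log_le {M : ℝ} (hN : 2 ≤ N) (hM : 16 * (N : ℝ) ^ 2 ≤ M) :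
    N * Real.log (2 * N * M) ≤ M := by
  have hN' : (2 : ℝ) ≤ N := by exact_mod_cast hN
  have hM0 : 0 < M := by nlinarith
  have h1 : Real.log (2 * N) ≤ 2 * N := (Real.log_le_sub_one_of_pos (by positivity)).trans
    (by linarith)
  have hs : √M * √M = M := Real.mul_self_sqrt hM0.le
  have hs0 := Real.sqrt_nonneg M
  have hs4 : 4 * (N : ℝ) ≤ √M := Real.le_sqrt_of_sq_le (by nlinarith)
  have h2 : Real.log M ≤ 2 * √M := by
    have := Real.log_le_sub_one_of_pos (Real.sqrt_pos.2 hM0)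
    rw [Real.log_sqrt hM0.le] at this
    linarith
  rw [Real.log_mul (by positivity) hM0.ne']
  nlinarith

theorem regretBound_eq (T : ℕ) {M δ : ℝ} (hM : M = 96 * Real.log T / δ ^ 2) :
    regretBound N T δ = 2 * N * M + N * Real.log (2 * N * M) + 3 * (N : ℝ) ^ 2 := by
  have : 192 * N * Real.log T / δ ^ 2 = 2 * N * M := by rw [hM]; ring
  rw [regretBound, this]

/-- The first sub-phase with enough explorations ends early enough. -/
theorem exists_subphase_of_samples {M : ℝ} (hN : 2 ≤ N) (hM : 16 * (N : ℝ) ^ 2 ≤ M) :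
    ∃ L : ℕ, M ≤ ((2 ^ (L + 2) - 2) / N : ℕ) ∧
      (L + 1 : ℝ) ≤ 2 * N * M + N * Real.log (2 * N * M) + 3 * (N : ℝ) ^ 2 ∧
      ((2 ^ (L + 2) - 2 : ℕ) + N * (L + 1) + N * (N + 1) / 2 - ((2 ^ (L + 2) - 2) / N : ℕ) +
        (N : ℝ) ^ 2) ≤ 2 * N * M + N * Real.log (2 * N * M) + 3 * (N : ℝ) ^ 2 := by
  have hN' : (2 : ℝ) ≤ N := by exact_mod_cast hN
  have hM64 : 64 ≤ M := by nlinarith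
  set n₀ := ⌊M⌋₊ + 1 with hn₀
  have hn₀M : M < n₀ := by rw [hn₀]; exact_mod_cast Nat.lt_floor_add_one M
  have hn₀M' : (n₀ : ℝ) ≤ M + 1 := by
    rw [hn₀]; push_cast; linarith [Nat.floor_le (by linarith : 0 ≤ M)]
  have hex : ∃ L, N * n₀ ≤ 2 ^ (L + 2) - 2 := by
    refine ⟨N * n₀, ?_⟩
    have := Nat.lt_two_pow_self (n := N * n₀)
    have := Nat.one_le_two_pow (n := N * n₀)
    rw [pow_add]
    omega
  have hL := Nat.find_spec hex
  set L := Nat.find hex with hLdef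
  have hdiv : n₀ ≤ (2 ^ (L + 2) - 2) / N := (Nat.le_div_iff_mul_le (by omega)).2 (by linarith)
  have hdivM : M ≤ ((2 ^ (L + 2) - 2) / N : ℕ) := hn₀M.le.trans (by exact_mod_cast hdiv)
  -- Minimality of `L`: one sub-phase earlier there were fewer than `N * n₀` explorations. So
  -- doubling overshoots by a factor of at most two.
  have hpow : 2 ^ (L + 1) ≤ N * n₀ + 1 := by
    rcases Nat.eq_zero_or_pos L with h0 | hpos
    · rw [h0]
      have : 1 * 1 ≤ N * n₀ := Nat.mul_le_mul (by omega) (by omega)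
      omega
    · have := Nat.find_min hex (m := L - 1) (by omega)
      have he : L - 1 + 2 = L + 1 := by omega
      rw [he] at this
      omega
  have hpow' : (2 : ℝ) ^ (L + 1) ≤ N * n₀ + 1 := by exact_mod_cast hpow
  have hNn : (N : ℝ) * n₀ ≤ N * M + N := by nlinarith
  have hE : ((2 ^ (L + 2) - 2 : ℕ) : ℝ) ≤ 2 * N * M + 2 * N := by
    rw [Nat.cast_sub (by have := two_le_two_pow_succ (L + 1); omega)]
    push_cast
    rw [pow_succ (2 : ℝ) (L + 1)]
    linarith
  -- Here `3 / 2` bounds `1 / log 2`. The excess `N * log (2 * N * M) / 2` over the stated bound is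
  -- at most `M / 2`, which is paid for by the at least `M` subtracted explorations of the core arm.
  have hlog : (L + 1 : ℝ) ≤ 3 / 2 * Real.log (2 * N * M) := by
    have h1 : Real.log ((2 : ℝ) ^ (L + 1)) ≤ Real.log (2 * N * M) :=
      Real.log_le_log (by positivity) (by nlinarith)
    rw [Real.log_pow] at h1
    push_cast at h1
    have h2 := Real.log_two_gt_d9
    have h3 : (0 : ℝ) ≤ L + 1 := by positivity
    nlinarith
  have hNlog := cast_mul_log_le hN hM
  have hlog0 : 0 ≤ Real.log (2 * N * M) := by
    have : (0 : ℝ) ≤ L := Nat.cast_nonneg L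
    linarith
  refine ⟨L, hdivM, ?_, ?_⟩
  · nlinarith
  · nlinarith

end Arithmetic

/-! ### Assembly of the theorem. -/

theorem sixteen_mul_sq_le {T : ℕ} {U : Fin N → Fin N → ℝ} (hN : 2 ≤ N) (hT : 2 ≤ T)
    (hU : ∀ i j, U i j ∈ Set.Icc (0 : ℝ) 1) (hinj : ∀ i, Function.Injective (U i)) :
    16 * (N : ℝ) ^ 2 ≤ 96 * Real.log T / minGap U ^ 2 := by
  have hδ := minGap_pos hN hinj
  have h1 := minGap_mul_le hN hinj hU
  have hlog := two_thirds_le_log hT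
  have hN' : (2 : ℝ) ≤ N := by exact_mod_cast hN
  rw [le_div_iff₀ (by positivity)]
  -- `N ≤ 2 * (N - 1)`. Then `16 * 2 ^ 2 = 64` is below `96 * 0.69`, hence below `96 * log T`.
  have h2 : minGap U * N ≤ 2 := by nlinarith
  have h3 : (minGap U * N) ^ 2 ≤ 2 ^ 2 := by gcongr
  nlinarith

theorem IsRewardModel.coreRegret_le {Ω : Type*} [MeasurableSpace Ω] {P : Measure Ω}
    [IsProbabilityMeasure P] {T : ℕ} {U : Fin N → Fin N → ℝ} {ξ : ℕ → Fin N → Fin N → Ω → ℝ}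
    {μ : Equiv.Perm (Fin N)} (h : IsRewardModel P U ξ) (hN : 2 ≤ N) (hT : 2 ≤ T)
    (hU : ∀ i j, U i j ∈ Set.Icc (0 : ℝ) 1) (hinj : ∀ i, Function.Injective (U i))
    (hμ : IsCoreMatching U μ) (i : Fin N) :
    coreRegret P T U μ ξ i ≤ regretBound N T (minGap U) * maxGap U μ i := by
  have hG := maxGap_nonneg (U := U) μ i
  set M := 96 * Real.log T / minGap U ^ 2 with hM
  -- If the bound exceeds the horizon it holds trivially. Otherwise the chosen sub-phase index is at
  -- most `T`, as the union bound requires.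
  rcases le_or_gt (T : ℝ) (regretBound N T (minGap U)) with hle | hlt
  · exact (h.coreRegret_le_horizon (by omega) i).trans (mul_le_mul_of_nonneg_right hle hG)
  · rw [regretBound_eq T hM] at hlt ⊢
    obtain ⟨L, h1, h2, h3⟩ := exists_subphase_of_samples hN (sixteen_mul_sq_le hN hT hU hinj)
    have hLT : L + 1 ≤ T := by exact_mod_cast h2.trans hlt.le
    refine (h.coreRegret_le_of_separated (by omega) hT hU hinj hμ hLT (fun m hm => ?_) i).trans
      (mul_le_mul_of_nonneg_right h3 hG)
    exact radius_le (minGap_pos hN hinj) hT hM (h1.trans (by exact_mod_cast hm))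

theorem regretBound_mul_maxGap_le {T : ℕ} {U : Fin N → Fin N → ℝ} (hN : 2 ≤ N) (hT : 2 ≤ T)
    (hU : ∀ i j, U i j ∈ Set.Icc (0 : ℝ) 1) (hinj : ∀ i, Function.Injective (U i))
    (μ : Equiv.Perm (Fin N)) (i : Fin N) :
    regretBound N T (minGap U) * maxGap U μ i ≤ 288 * (N * Real.log T / minGap U ^ 2) := by
  have hN' : (2 : ℝ) ≤ N := by exact_mod_cast hN
  have h16 := sixteen_mul_sq_le hN hT hU hinj
  have hC : 288 * (N * Real.log T / minGap U ^ 2) =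
    3 * N * (96 * Real.log T / minGap U ^ 2) := by ring
  rw [hC, regretBound_eq T rfl]
  generalize 96 * Real.log T / minGap U ^ 2 = M at *
  have hlog := cast_mul_log_le hN h16
  -- The last two terms are at most `M + 3 * M / 16 ≤ N * M`. This gives the absolute constant `288
  -- = 3 * 96`.
  have h1 : 2 * N * M + N * Real.log (2 * N * M) + 3 * (N : ℝ) ^ 2 ≤ 3 * N * M := by nlinarith
  have hM : 0 ≤ M := by nlinarith
  calc _ ≤ 3 * N * M * maxGap U μ i := mul_le_mul_of_nonneg_right h1 (maxGap_nonneg μ i)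
    _ ≤ 3 * N * M := mul_le_of_le_one_right (by positivity) (maxGap_le_one hU μ i)

end HousingMarket

end

theorem theorem1 :
    ∃ C : ℝ, 0 < C ∧
      ∀ (N T : ℕ) (_hN : 2 ≤ N) (_hT : 2 ≤ T)
        (U : Fin N → Fin N → ℝ) (_hU : ∀ i j, U i j ∈ Set.Icc (0 : ℝ) 1)
        (_hinj : ∀ i, Function.Injective (U i))
        (μ : Equiv.Perm (Fin N)) (_hμ : HousingMarket.IsCoreMatching U μ)
        (Ω : Type*) [MeasurableSpace Ω] (P : MeasureTheory.Measure Ω)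
        [MeasureTheory.IsProbabilityMeasure P]
        (ξ : ℕ → Fin N → Fin N → Ω → ℝ) (_hξ : HousingMarket.IsRewardModel P U ξ)
        (i : Fin N),
        MeasureTheory.Integrable (HousingMarket.totalReward T ξ i) P ∧
        HousingMarket.coreRegret P T U μ ξ i ≤
          HousingMarket.regretBound N T (HousingMarket.minGap U) * HousingMarket.maxGap U μ i ∧
        HousingMarket.regretBound N T (HousingMarket.minGap U) * HousingMarket.maxGap U μ i ≤
          C * (N * Real.log T / HousingMarket.minGap U ^ 2) := by
  refine ⟨288, by norm_num, ?_⟩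
  intro N T hN hT U hU hinj μ hμ Ω _ P _ ξ hξ i
  exact ⟨hξ.integrable_totalReward (by omega) T i, hξ.coreRegret_le hN hT hU hinj hμ i,
    HousingMarket.regretBound_mul_maxGap_le hN hT hU hinj μ i⟩
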